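/- Let $\mathbf k$ be a field, $E$ a set species, $\mathbf M_E$ the free (symmetric) set operad generated by $E$, $\mathcal M_E=\mathbf k\mathbf M_E$ its linearization, and let $\mathcal P=\mathcal M_E/\mathcal R$, where $\mathcal R$ is the operadic ideal generated by finitely many elements $\mu^1,\dots,\mu^N$ of $\mathcal M_E$. Let $\pi:\mathcal M_E\to\mathcal P$ be the projection. Let $Ⓡ$ be the finest equivalence relation on $\mathbf M_E$ compatible with the operad structure for which any two monomials occurring with non-zero coefficient in the same $\mu^i$ are equivalent, and let $Ⓟ=\mathbf M_E/Ⓡ$ be the associated set operad. Let $\Omega$ be a $Ⓟ$-algebra in sets; for $\mu\in(\mathbf M_E)_A$ and $\alpha\in\Omega^A$ write $\mu(\alpha)\in\Omega$ for the result of applying the class of $\mu$ to $\alpha$. Let $\mathcal P^\Omega$ and $\mathcal M_E^\Omega$ be the uniform $\Omega$-coloured operads, $\mathcal P^\Omega_{A,\alpha,\omega}=\mathcal P_A$ and $(\mathcal M_E^\Omega)_{A,\alpha,\omega}=(\mathcal M_E)_A$. Let $\widetilde{\mathcal P}^\Omega\subset\mathcal P^\Omega$ be the coloured suboperad with $\widetilde{\mathcal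 P}^\Omega_{A,\alpha,\omega}=\pi\big(\mathrm{span}\{\mu\in(\mathbf M_E)_A:\mu(\alpha)=\omega\}\big)$. Let $\mathcal J$ be the two-sided coloured operadic ideal of $\mathcal M_E^\Omega$ generated by the subspaces $\mathcal I_{A,\alpha,\omega}=\mathrm{span}\{\mu\in(\mathbf M_E)_A:\mu(\alpha)\ne\omega\}$, and let $\widetilde{\widetilde{\mathcal P}}{}^\Omega=\mathcal P^\Omega/\pi(\mathcal J)$ be the color-mixing operad. For a vector space $V$ let $\mathcal U(V)$ be the $\Omega$-graded vector space all of whose components are $V$; an $\Omega$-family $\mathcal P$-algebra structure on $V$ is a morphism of coloured operads $\Phi:\widetilde{\widetilde{\mathcal P}}{}^\Omega\to\mathrm{End}(\mathcal U(V))$. Then: 1. For every $\Omega$-family $\mathcal P$-algebra structure $\Phi$ on $V$, there is exactly one $\mathcal P$-algebra structure on the vector space $V\otimes\mathbf k\Omega$ in which, for every finite set $A$, every $\mu\in(\mathbf M_E)_A$, $\alpha\in\Omega^A$ and $v\in V^A$, the operation $\pi(\mu)$ satisfies $$\pi(\mu)\big((v_a\otimes\alpha_a)_{a\in A}\big)=\Phi_{A,\alpha,\mu(\alpha)}\big([\pi(\mu)]\big)(v)\otimes\mu(\alpha).$$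 2. The same holds for every morphism of coloured operads $\Phi:\widetilde{\mathcal P}^\Omega\to\mathrm{End}(\mathcal U(V))$, with $[\pi(\mu)]$ replaced by $\pi(\mu)\in\widetilde{\mathcal P}^\Omega_{A,\alpha,\mu(\alpha)}$. 3. Suppose $\Omega\neq\emptyset$. For every $\Omega$-family $\mathcal P$-algebra structure $\Phi$ on $V$, the products $\prod_{(\alpha,\omega)\in\Omega^A\times\Omega}\widetilde{\widetilde{\mathcal P}}{}^\Omega_{A,\alpha,\omega}$, with componentwise action of bijections, the family of all units as unit, and partial compositions computed by (finite) summation over the intermediate colour, form an ordinary operad $\overline{\mathcal F}(\widetilde{\widetilde{\mathcal P}}{}^\Omega)$, and $V$ is an algebra over it in such a way that each element of the component of colour $(A,\alpha,\omega)$ acts by its image under $\Phi_{A,\alpha,\omega}$. -/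

import Mathlib

open scoped TensorProduct

set_option linter.unusedSectionVars false

universe u w v v₁ v₂ v₃ x

namespace FamilyAlg

noncomputable section

/-! ### Finite sets, grafting of finite sets, and the canonical bijections -/

/-- `A ⊔ₐ B = (A \ {a}) ⊔ B`. -/
abbrev Graft (A : Type) (a : A) (B : Type) : Type := {i : A // i ≠ a} ⊕ B

/-- The colouring `α ⊔ₐ β` of `A ⊔ₐ B`. -/
@[reducible] def graftColor {Ω : Type w} {A B : Type} (α : A → Ω) (a : A) (β : B → Ω) : Graft A a B → Ω
  | Sum.inl i => α i.1
  | Sum.inr j => β j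

/-- Functoriality of `A ⊔ₐ B` with respect to bijections. -/
def graftEquiv {A A' B B' : Type} (φ : A' ≃ A) (ψ : B' ≃ B) (a : A') :
    Graft A' a B' ≃ Graft A (φ a) B :=
  Equiv.sumCongr (φ.subtypeEquiv fun _ => not_congr φ.injective.eq_iff.symm) ψ

/-- `{*} ⊔_* B = B`. -/
def unitGraft (B : Type) : Graft Unit () B ≃ B where
  toFun
    | Sum.inl i => (i.2 rfl).elim
    | Sum.inr j => j
  invFun := Sum.inr
  left_inv := by rintro (⟨i, hi⟩ | j); exacts [(hi rfl).elim, rfl]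
  right_inv _ := rfl

open Classical in
/-- `A ⊔ₐ {*} ≃ A`, sending `*` to `a`. -/
def graftUnit (A : Type) (a : A) : Graft A a Unit ≃ A where
  toFun
    | Sum.inl i => i.1
    | Sum.inr _ => a
  invFun i := if h : i = a then Sum.inr () else Sum.inl ⟨i, h⟩
  left_inv := by
    rintro (⟨i, hi⟩ | j)
    · simp [hi]
    · simp
  right_inv i := by
    by_cases h : i = a <;> simp [h]

/-- `(A ⊔ₐ B) ⊔_b C = A ⊔ₐ (B ⊔_b C)` for `a ∈ A`, `b ∈ B`. -/
def seqEquiv (A B C : Type) (a : A) (b : B) :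
    Graft (Graft A a B) (Sum.inr b) C ≃ Graft A a (Graft B b C) where
  toFun
    | Sum.inl ⟨Sum.inl i, _⟩ => Sum.inl i
    | Sum.inl ⟨Sum.inr j, h⟩ => Sum.inr (Sum.inl ⟨j, fun e => h (e ▸ rfl)⟩)
    | Sum.inr l => Sum.inr (Sum.inr l)
  invFun
    | Sum.inl i => Sum.inl ⟨Sum.inl i, Sum.inl_ne_inr⟩
    | Sum.inr (Sum.inl j) => Sum.inl ⟨Sum.inr j.1, fun e => j.2 (Sum.inr.inj e)⟩
    | Sum.inr (Sum.inr l) => Sum.inr l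
  left_inv := by rintro (⟨i | j, h⟩ | l) <;> rfl
  right_inv := by rintro (i | j | l) <;> rfl

/-- One half of the bijection `(A ⊔ₐ B) ⊔_{a'} C = (A ⊔_{a'} C) ⊔ₐ B`. -/
def parFun (A B C : Type) (a a' : A) (h : a' ≠ a) (h' : a ≠ a') :
    Graft (Graft A a B) (Sum.inl ⟨a', h⟩) C → Graft (Graft A a' C) (Sum.inl ⟨a, h'⟩) B
  | Sum.inl ⟨Sum.inl i, hi⟩ =>
      Sum.inl ⟨Sum.inl ⟨i.1, fun e => hi (congrArg Sum.inl (Subtype.ext e))⟩,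
        fun e => i.2 (congrArg Subtype.val (Sum.inl.inj e))⟩
  | Sum.inl ⟨Sum.inr j, _⟩ => Sum.inr j
  | Sum.inr l => Sum.inl ⟨Sum.inr l, Sum.inr_ne_inl⟩

/-- `(A ⊔ₐ B) ⊔_{a'} C = (A ⊔_{a'} C) ⊔ₐ B` for distinct `a, a' ∈ A`. -/
def parEquiv (A B C : Type) (a a' : A) (h : a' ≠ a) :
    Graft (Graft A a B) (Sum.inl ⟨a', h⟩) C ≃ Graft (Graft A a' C) (Sum.inl ⟨a, h.symm⟩) B where
  toFun := parFun A B C a a' h h.symm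
  invFun := parFun A C B a' a h.symm h
  left_inv := by rintro (⟨i | j, h⟩ | l) <;> rfl
  right_inv := by rintro (⟨i | j, h⟩ | l) <;> rfl

section colors

variable {Ω : Type w} {A A' B B' C : Type}

theorem graftColor_graftEquiv {α : A → Ω} {α' : A' → Ω} {β : B → Ω} {β' : B' → Ω}
    (φ : A' ≃ A) (ψ : B' ≃ B) (a : A') (hα : ∀ i, α' i = α (φ i)) (hβ : ∀ j, β' j = β (ψ j)) :
    ∀ i, graftColor α' a β' i = graftColor α (φ a) β (graftEquiv φ ψ a i) := by
  rintro (i | j)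
  exacts [hα _, hβ _]

theorem graftColor_unitGraft (ω : Ω) (β : B → Ω) :
    ∀ i, graftColor (fun _ : Unit => ω) () β i = β (unitGraft B i) := by
  rintro (⟨i, hi⟩ | j)
  exacts [(hi rfl).elim, rfl]

theorem graftColor_graftUnit (α : A → Ω) (a : A) :
    ∀ i, graftColor α a (fun _ : Unit => α a) i = α (graftUnit A a i) := by
  rintro (i | j) <;> rfl

theorem graftColor_seq (α : A → Ω) (a : A) (β : B → Ω) (b : B) (γ : C → Ω) :
    ∀ i, graftColor (graftColor α a β) (Sum.inr b) γ i =
      graftColor α a (graftColor β b γ) (seqEquiv A B C a b i) := by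
  rintro (⟨i | j, h⟩ | l) <;> rfl

theorem graftColor_par (α : A → Ω) (a a' : A) (h : a' ≠ a) (β : B → Ω) (γ : C → Ω) :
    ∀ i, graftColor (graftColor α a β) (Sum.inl ⟨a', h⟩) γ i =
      graftColor (graftColor α a' γ) (Sum.inl ⟨a, h.symm⟩) β (parEquiv A B C a a' h i) := by
  rintro (⟨i | j, h⟩ | l) <;> rfl

end colors

/-! ### Coloured operads in sets and in vector spaces -/

/-- An `Ω`-coloured operad in the category of sets, in the species formalism, given by its units
and partial compositions.  A morphism `(A, α, ω) ⟶ (B, β, ω)` of `Ω`-coloured finite sets is a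
bijection `φ : A ≃ B` with `α = β ∘ φ`, and it acts contravariantly.  The partial composition
`comp a p q` is only present when the output colour `ζ` of `q` is the colour `α a`.
Ordinary (monochromatic) operads are the case `Ω = Unit`. -/
structure ColoredOperad (Ω : Type w) where
  obj : (A : Type) → [Finite A] → (A → Ω) → Ω → Type v
  map : ∀ {A B : Type} [Finite A] [Finite B] (φ : A ≃ B) {α : A → Ω} {β : B → Ω} {ω : Ω},
    (∀ i, α i = β (φ i)) → obj B β ω → obj A α ω
  one : ∀ ω : Ω, obj Unit (fun _ => ω) ω
  comp : ∀ {A B : Type} [Finite A] [Finite B] (a : A) {α : A → Ω} {β : B → Ω} {ω ζ : Ω},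
    obj A α ω → obj B β ζ → ζ = α a → obj (Graft A a B) (graftColor α a β) ω
  map_refl : ∀ {A : Type} [Finite A] {α : A → Ω} {ω : Ω} (p : obj A α ω),
    map (Equiv.refl A) (fun _ => rfl) p = p
  map_trans : ∀ {A B C : Type} [Finite A] [Finite B] [Finite C] (φ : A ≃ B) (ψ : B ≃ C)
    {α : A → Ω} {β : B → Ω} {γ : C → Ω} {ω : Ω} (hα : ∀ i, α i = β (φ i))
    (hβ : ∀ j, β j = γ (ψ j)) (p : obj C γ ω),
    map (φ.trans ψ) (fun i => (hα i).trans (hβ (φ i))) p = map φ hα (map ψ hβ p)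
  comp_map : ∀ {A A' B B' : Type} [Finite A] [Finite A'] [Finite B] [Finite B']
    (φ : A' ≃ A) (ψ : B' ≃ B) (a : A') {α : A → Ω} {α' : A' → Ω} {β : B → Ω} {β' : B' → Ω}
    {ω ζ : Ω} (hα : ∀ i, α' i = α (φ i)) (hβ : ∀ j, β' j = β (ψ j))
    (p : obj A α ω) (q : obj B β ζ) (h : ζ = α (φ a)),
    comp a (map φ hα p) (map ψ hβ q) (h.trans (hα a).symm) =
      map (graftEquiv φ ψ a) (graftColor_graftEquiv φ ψ a hα hβ) (comp (φ a) p q h)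
  one_comp : ∀ {B : Type} [Finite B] {β : B → Ω} {ω : Ω} (q : obj B β ω),
    comp () (one ω) q rfl = map (unitGraft B) (graftColor_unitGraft ω β) q
  comp_one : ∀ {A : Type} [Finite A] {α : A → Ω} {ω : Ω} (a : A) (p : obj A α ω),
    comp a p (one (α a)) rfl = map (graftUnit A a) (graftColor_graftUnit α a) p
  comp_seq : ∀ {A B C : Type} [Finite A] [Finite B] [Finite C] (a : A) (b : B)
    {α : A → Ω} {β : B → Ω} {γ : C → Ω} {ω ζ ξ : Ω}
    (p : obj A α ω) (q : obj B β ζ) (r : obj C γ ξ) (hq : ζ = α a) (hr : ξ = β b),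
    comp (Sum.inr b) (comp a p q hq) r hr =
      map (seqEquiv A B C a b) (graftColor_seq α a β b γ) (comp a p (comp b q r hr) hq)
  comp_par : ∀ {A B C : Type} [Finite A] [Finite B] [Finite C] (a a' : A) (h : a' ≠ a)
    {α : A → Ω} {β : B → Ω} {γ : C → Ω} {ω ζ ξ : Ω}
    (p : obj A α ω) (q : obj B β ζ) (r : obj C γ ξ) (hq : ζ = α a) (hr : ξ = α a'),
    comp (Sum.inl ⟨a', h⟩ : Graft A a B) (comp a p q hq) r hr =
      map (parEquiv A B C a a' h) (graftColor_par α a a' h β γ)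
        (comp (Sum.inl ⟨a, h.symm⟩ : Graft A a' C) (comp a' p r hr) q hq)

/-- Morphisms of `Ω`-coloured operads in sets. -/
structure ColoredOperad.Hom {Ω : Type w} (P : ColoredOperad.{w, v₁} Ω)
    (Q : ColoredOperad.{w, v₂} Ω) where
  app : ∀ (A : Type) [Finite A] (α : A → Ω) (ω : Ω), P.obj A α ω → Q.obj A α ω
  app_map : ∀ {A B : Type} [Finite A] [Finite B] (φ : A ≃ B) {α : A → Ω} {β : B → Ω} {ω : Ω}
    (h : ∀ i, α i = β (φ i)) (p : P.obj B β ω),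
    app A α ω (P.map φ h p) = Q.map φ h (app B β ω p)
  app_one : ∀ ω : Ω, app Unit (fun _ => ω) ω (P.one ω) = Q.one ω
  app_comp : ∀ {A B : Type} [Finite A] [Finite B] (a : A) {α : A → Ω} {β : B → Ω} {ω ζ : Ω}
    (p : P.obj A α ω) (q : P.obj B β ζ) (h : ζ = α a),
    app (Graft A a B) (graftColor α a β) ω (P.comp a p q h) =
      Q.comp a (app A α ω p) (app B β ζ q) h

/-- An `Ω`-coloured operad in the category of `k`-vector spaces. -/
structure LinOperad (k : Type u) [Field k] (Ω : Type w) extends ColoredOperad.{w, v} Ω where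
  [addCommGroup : ∀ (A : Type) [Finite A] (α : A → Ω) (ω : Ω), AddCommGroup (obj A α ω)]
  [module : ∀ (A : Type) [Finite A] (α : A → Ω) (ω : Ω), Module k (obj A α ω)]
  map_add : ∀ {A B : Type} [Finite A] [Finite B] (φ : A ≃ B) {α : A → Ω} {β : B → Ω} {ω : Ω}
    (h : ∀ i, α i = β (φ i)) (p p' : obj B β ω), map φ h (p + p') = map φ h p + map φ h p'
  map_smul : ∀ {A B : Type} [Finite A] [Finite B] (φ : A ≃ B) {α : A → Ω} {β : B → Ω} {ω : Ω}
    (h : ∀ i, α i = β (φ i)) (c : k) (p : obj B β ω), map φ h (c • p) = c • map φ h p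
  add_comp : ∀ {A B : Type} [Finite A] [Finite B] (a : A) {α : A → Ω} {β : B → Ω} {ω ζ : Ω}
    (p p' : obj A α ω) (q : obj B β ζ) (h : ζ = α a),
    comp a (p + p') q h = comp a p q h + comp a p' q h
  smul_comp : ∀ {A B : Type} [Finite A] [Finite B] (a : A) {α : A → Ω} {β : B → Ω} {ω ζ : Ω}
    (c : k) (p : obj A α ω) (q : obj B β ζ) (h : ζ = α a),
    comp a (c • p) q h = c • comp a p q h
  comp_add : ∀ {A B : Type} [Finite A] [Finite B] (a : A) {α : A → Ω} {β : B → Ω} {ω ζ : Ω}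
    (p : obj A α ω) (q q' : obj B β ζ) (h : ζ = α a),
    comp a p (q + q') h = comp a p q h + comp a p q' h
  comp_smul : ∀ {A B : Type} [Finite A] [Finite B] (a : A) {α : A → Ω} {β : B → Ω} {ω ζ : Ω}
    (c : k) (p : obj A α ω) (q : obj B β ζ) (h : ζ = α a),
    comp a p (c • q) h = c • comp a p q h

attribute [instance] LinOperad.addCommGroup LinOperad.module

/-- Morphisms of `Ω`-coloured operads in vector spaces. -/
structure LinOperad.Hom {k : Type u} [Field k] {Ω : Type w} (P : LinOperad.{u, w, v₁} k Ω)
    (Q : LinOperad.{u, w, v₂} k Ω) extends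
    ColoredOperad.Hom P.toColoredOperad Q.toColoredOperad where
  app_add : ∀ {A : Type} [Finite A] {α : A → Ω} {ω : Ω} (p q : P.obj A α ω),
    app A α ω (p + q) = app A α ω p + app A α ω q
  app_smul : ∀ {A : Type} [Finite A] {α : A → Ω} {ω : Ω} (c : k) (p : P.obj A α ω),
    app A α ω (c • p) = c • app A α ω p

/-! ### The endomorphism operads -/

/-- The endomorphism operad of a set: all maps `X^A → X`. -/
def endSet (X : Type x) : ColoredOperad.{0, x} Unit where
  obj A _ _ _ := (A → X) → X
  map φ _ _ _ _ f := fun s => f (s ∘ φ.symm)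
  one _ := fun s => s ()
  comp a _ _ _ _ f g _ := by
    classical
    exact fun s => f fun i => if h : i = a then g (fun j => s (Sum.inr j)) else s (Sum.inl ⟨i, h⟩)
  map_refl _ := rfl
  map_trans _ _ _ _ _ _ _ _ _ := rfl
  comp_map φ ψ a _ _ _ _ _ _ _ _ f g _ := by
    funext s
    dsimp only
    congr 1
    funext i
    by_cases h : i = φ a
    · subst h
      simp [graftEquiv]
      rfl
    · have h' : φ.symm i ≠ a := fun e => h (by simp [← e])
      simp [h, h', graftEquiv]
  one_comp q := by
    funext s
    simp [unitGraft]
    rfl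
  comp_one a p := by
    funext s
    dsimp only
    congr 1
    funext i
    by_cases h : i = a <;> simp [h, graftUnit]
  comp_seq a b _ _ _ _ _ _ p q r _ _ := by
    funext s
    dsimp only
    congr 1
    funext i
    by_cases h : i = a
    · subst h
      simp only [dite_true]
      congr 1
      funext j
      by_cases h' : j = b
      · subst h'; simp [seqEquiv]
      · simp [h', seqEquiv]
    · simp [h, seqEquiv]
  comp_par a a' hne _ _ _ _ _ _ p q r _ _ := by
    funext s
    dsimp only
    congr 1
    funext i
    by_cases h : i = a
    · subst h
      simp [hne.symm, parEquiv, parFun]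
    · by_cases h' : i = a'
      · subst h'
        simp [h, parEquiv, parFun]
      · simp [h, h', parEquiv, parFun]

/-- The identification of two components of a graded vector space with equal degrees. -/
def degCast {k : Type u} [Field k] {Ω : Type w} (𝒱 : Ω → Type x) [∀ ω, AddCommGroup (𝒱 ω)]
    [∀ ω, Module k (𝒱 ω)] {ω ω' : Ω} (h : ω = ω') : 𝒱 ω →ₗ[k] 𝒱 ω' :=
  h ▸ LinearMap.id

section endGraded

variable {k : Type u} [Field k] {Ω : Type w} (𝒱 : Ω → Type x) [∀ ω, AddCommGroup (𝒱 ω)]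
  [∀ ω, Module k (𝒱 ω)]

@[simp] theorem degCast_rfl {ω : Ω} (h : ω = ω) (v : 𝒱 ω) : degCast (k := k) 𝒱 h v = v := rfl

@[simp] theorem degCast_degCast {ω ω' ω'' : Ω} (h : ω = ω') (h' : ω' = ω'') (v : 𝒱 ω) :
    degCast (k := k) 𝒱 h' (degCast (k := k) 𝒱 h v) = degCast (k := k) 𝒱 (h.trans h') v := by
  subst h; rfl

theorem degCast_apply {A : Type} {α : A → Ω} (v : ∀ i, 𝒱 (α i)) {i i' : A} (e : i = i')
    {ω : Ω} (h : α i = ω) :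
    degCast (k := k) 𝒱 h (v i) = degCast (k := k) 𝒱 ((congrArg α e).symm.trans h) (v i') := by
  subst e; rfl

/-- Change of a family of vectors along a bijection respecting the colours. -/
def pullVec {A B : Type} (φ : A ≃ B) {α : A → Ω} {β : B → Ω} (h : ∀ i, α i = β (φ i))
    (v : ∀ i, 𝒱 (α i)) (j : B) : 𝒱 (β j) :=
  degCast (k := k) 𝒱 ((h (φ.symm j)).trans (congrArg β (φ.apply_symm_apply j))) (v (φ.symm j))

theorem pullVec_apply {A B : Type} (φ : A ≃ B) {α : A → Ω} {β : B → Ω} (h : ∀ i, α i = β (φ i))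
    (v : ∀ i, 𝒱 (α i)) (i : A) :
    pullVec (k := k) 𝒱 φ h v (φ i) = degCast (k := k) 𝒱 (h i) (v i) :=
  degCast_apply 𝒱 v (φ.symm_apply_apply i) _

theorem pullVec_update {A B : Type} [DecidableEq A] [DecidableEq B] (φ : A ≃ B) {α : A → Ω}
    {β : B → Ω} (h : ∀ i, α i = β (φ i)) (v : ∀ i, 𝒱 (α i)) (i : A) (y : 𝒱 (α i)) :
    pullVec (k := k) 𝒱 φ h (Function.update v i y) =
      Function.update (pullVec (k := k) 𝒱 φ h v) (φ i) (degCast (k := k) 𝒱 (h i) y) := by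
  funext j
  obtain ⟨i', rfl⟩ := φ.surjective j
  rw [pullVec_apply]
  by_cases e : i' = i
  · subst e; simp
  · rw [Function.update_of_ne e, Function.update_of_ne (φ.injective.ne e), pullVec_apply]

open Classical in
/-- The family `(v_i)_{i ≠ a}` completed by the vector `y` in position `a`. -/
def insertVec {A : Type} (a : A) {α : A → Ω} {ζ : Ω} (h : ζ = α a)
    (v : ∀ i : {i : A // i ≠ a}, 𝒱 (α i.1)) (y : 𝒱 ζ) (i : A) : 𝒱 (α i) :=
  if e : i = a then degCast (k := k) 𝒱 (h.trans (congrArg α e.symm)) y else v ⟨i, e⟩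

theorem insertVec_self {A : Type} (a : A) {α : A → Ω} {ζ : Ω} (h : ζ = α a)
    (v : ∀ i : {i : A // i ≠ a}, 𝒱 (α i.1)) (y : 𝒱 ζ) :
    insertVec (k := k) 𝒱 a h v y a = degCast (k := k) 𝒱 h y := by
  simp [insertVec]

theorem insertVec_of_ne {A : Type} (a : A) {α : A → Ω} {ζ : Ω} (h : ζ = α a)
    (v : ∀ i : {i : A // i ≠ a}, 𝒱 (α i.1)) (y : 𝒱 ζ) {i : A} (e : i ≠ a) :
    insertVec (k := k) 𝒱 a h v y i = v ⟨i, e⟩ :=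
  dif_neg e

theorem insertVec_eq_update {A : Type} [DecidableEq A] (a : A) {α : A → Ω} {ζ : Ω}
    (h : ζ = α a) (v : ∀ i : {i : A // i ≠ a}, 𝒱 (α i.1)) (y : 𝒱 ζ) :
    insertVec (k := k) 𝒱 a h v y =
      Function.update (insertVec (k := k) 𝒱 a h v 0) a (degCast (k := k) 𝒱 h y) := by
  funext i
  by_cases e : i = a
  · subst e; simp [insertVec_self]
  · rw [Function.update_of_ne e, insertVec_of_ne 𝒱 a h v y e, insertVec_of_ne 𝒱 a h v 0 e]

theorem insertVec_update {A : Type} [DecidableEq A] (a : A) {α : A → Ω} {ζ : Ω}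
    (h : ζ = α a) (v : ∀ i : {i : A // i ≠ a}, 𝒱 (α i.1)) (y : 𝒱 ζ) (i : {i : A // i ≠ a})
    (z : 𝒱 (α i.1)) :
    insertVec (k := k) 𝒱 a h (Function.update v i z) y =
      Function.update (insertVec (k := k) 𝒱 a h v y) i.1 z := by
  funext j
  by_cases e : j = a
  · subst e
    rw [Function.update_of_ne i.2.symm, insertVec_self, insertVec_self]
  · rw [insertVec_of_ne 𝒱 a h _ y e]
    by_cases e' : j = i.1
    · subst e'
      exact (Function.update_self (β := fun i : {i : A // i ≠ a} => 𝒱 (α i.1)) i z v).trans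
        (Function.update_self (β := fun i : A => 𝒱 (α i)) i.1 z _).symm
    · rw [Function.update_of_ne e', insertVec_of_ne 𝒱 a h _ y e]
      exact Function.update_of_ne (fun e'' : (⟨j, e⟩ : {i : A // i ≠ a}) = i =>
        e' (congrArg Subtype.val e'')) _ _

/-- Restriction of a family of vectors indexed by `A ⊔ₐ B` to `A \ {a}`. -/
def vecLeft {A B : Type} {a : A} {α : A → Ω} {β : B → Ω} (v : ∀ i, 𝒱 (graftColor α a β i))
    (i : {i : A // i ≠ a}) : 𝒱 (α i.1) := v (Sum.inl i)

/-- Restriction of a family of vectors indexed by `A ⊔ₐ B` to `B`. -/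
def vecRight {A B : Type} {a : A} {α : A → Ω} {β : B → Ω} (v : ∀ i, 𝒱 (graftColor α a β i))
    (j : B) : 𝒱 (β j) := v (Sum.inr j)

section

variable {A B : Type} {a : A} {α : A → Ω} {β : B → Ω} [DecidableEq (Graft A a B)]
  [DecidableEq A] [DecidableEq B] (v : ∀ i, 𝒱 (graftColor α a β i))

theorem vecLeft_update_inl (i : {i : A // i ≠ a}) (z : 𝒱 (α i.1)) :
    vecLeft 𝒱 (Function.update v (Sum.inl i) z) = Function.update (vecLeft 𝒱 v) i z := by
  funext j
  by_cases e : j = i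
  · subst e; rw [Function.update_self]; exact Function.update_self _ _ _
  · rw [Function.update_of_ne e]
    exact Function.update_of_ne (fun e' => e (Sum.inl.inj e')) _ _

theorem vecLeft_update_inr (j : B) (z : 𝒱 (β j)) :
    vecLeft 𝒱 (Function.update v (Sum.inr j) z) = vecLeft 𝒱 v := by
  funext i
  exact Function.update_of_ne Sum.inl_ne_inr _ _

theorem vecRight_update_inl (i : {i : A // i ≠ a}) (z : 𝒱 (α i.1)) :
    vecRight 𝒱 (Function.update v (Sum.inl i) z) = vecRight 𝒱 v := by
  funext j
  exact Function.update_of_ne Sum.inr_ne_inl _ _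

theorem vecRight_update_inr (j : B) (z : 𝒱 (β j)) :
    vecRight 𝒱 (Function.update v (Sum.inr j) z) = Function.update (vecRight 𝒱 v) j z := by
  funext i
  by_cases e : i = j
  · subst e; rw [Function.update_self]; exact Function.update_self _ _ _
  · rw [Function.update_of_ne e]
    exact Function.update_of_ne (fun e' => e (Sum.inr.inj e')) _ _

end

variable (k)

/-- The endomorphism operad of the `Ω`-graded vector space `𝒱`: its component of colour `(A, α, ω)`
is `Hom (⨂ a, 𝒱 (α a)) (𝒱 ω)`, the space of multilinear maps. -/
def endGraded : LinOperad.{u, w, x} k Ω where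
  obj A _ α ω := MultilinearMap k (fun i : A => 𝒱 (α i)) (𝒱 ω)
  map φ _ _ _ h f :=
    { toFun := fun v => f (pullVec (k := k) 𝒱 φ h v)
      map_update_add' := by
        classical
        intro _ v i y y'
        simp only [pullVec_update, _root_.map_add, f.map_update_add]
      map_update_smul' := by
        classical
        intro _ v i c y
        simp only [pullVec_update, _root_.map_smul, f.map_update_smul] }
  one ω :=
    { toFun := fun v : Unit → 𝒱 ω => v ()
      map_update_add' := by intro _ v i y y'; simp
      map_update_smul' := by intro _ v i c y; simp only [Function.update_self] }
  comp a _ _ _ _ f g h :=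
    { toFun := fun v => f (insertVec (k := k) 𝒱 a h (vecLeft 𝒱 v) (g (vecRight 𝒱 v)))
      map_update_add' := by
        classical
        intro _ v i y y'
        obtain i | j := i
        · rw [vecLeft_update_inl, vecLeft_update_inl, vecLeft_update_inl, vecRight_update_inl,
            vecRight_update_inl, vecRight_update_inl, insertVec_update, insertVec_update,
            insertVec_update]
          exact f.map_update_add _ _ _ _
        · rw [vecLeft_update_inr, vecLeft_update_inr, vecLeft_update_inr, vecRight_update_inr,
            vecRight_update_inr, vecRight_update_inr, g.map_update_add, insertVec_eq_update,
            insertVec_eq_update 𝒱 a h _ (g (Function.update _ j y)),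
            insertVec_eq_update 𝒱 a h _ (g (Function.update _ j y')), _root_.map_add]
          exact f.map_update_add _ _ _ _
      map_update_smul' := by
        classical
        intro _ v i c y
        obtain i | j := i
        · rw [vecLeft_update_inl, vecLeft_update_inl, vecRight_update_inl,
            vecRight_update_inl, insertVec_update, insertVec_update]
          exact f.map_update_smul _ _ _ _
        · rw [vecLeft_update_inr, vecLeft_update_inr, vecRight_update_inr,
            vecRight_update_inr, g.map_update_smul, insertVec_eq_update,
            insertVec_eq_update 𝒱 a h _ (g _), _root_.map_smul]
          exact f.map_update_smul _ _ _ _ }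
  map_refl p := by
    ext v; rfl
  map_trans φ ψ _ _ _ _ hα hβ p := by
    ext v
    refine congrArg p ?_
    funext l
    obtain ⟨j, rfl⟩ := ψ.surjective l
    obtain ⟨i, rfl⟩ := φ.surjective j
    have e := pullVec_apply (k := k) 𝒱 (φ.trans ψ) (fun i => (hα i).trans (hβ (φ i))) v i
    rw [pullVec_apply, pullVec_apply, degCast_degCast]
    exact e
  comp_map φ ψ a α α' β β' ω ζ hα hβ p q h := by
    ext v
    refine congrArg p ?_
    have key := pullVec_apply (k := k) 𝒱 (graftEquiv φ ψ a) (graftColor_graftEquiv φ ψ a hα hβ) v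
    funext i
    obtain ⟨i, rfl⟩ := φ.surjective i
    rw [pullVec_apply]
    by_cases e : i = a
    · subst e
      rw [insertVec_self, insertVec_self, degCast_degCast]
      refine congrArg _ (congrArg q ?_)
      funext j
      obtain ⟨j, rfl⟩ := ψ.surjective j
      rw [pullVec_apply]
      exact (key (Sum.inr j)).symm
    · rw [insertVec_of_ne _ _ _ _ _ e, insertVec_of_ne _ _ _ _ _ (φ.injective.ne e)]
      exact (key (Sum.inl ⟨i, e⟩)).symm
  one_comp {B} _ {β ω} q := by
    ext v
    have key := pullVec_apply (k := k) 𝒱 (unitGraft B) (graftColor_unitGraft ω β) v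
    refine (insertVec_self (k := k) 𝒱 (α := fun _ : Unit => ω) () rfl _ _).trans
      (congrArg q ?_)
    funext j
    exact (key (Sum.inr j)).symm
  comp_one {A} _ {α ω} a p := by
    ext v
    refine congrArg p ?_
    have key := pullVec_apply (k := k) 𝒱 (graftUnit A a) (graftColor_graftUnit α a) v
    funext i
    by_cases e : i = a
    · subst e
      rw [insertVec_self, degCast_rfl]
      exact (key (Sum.inr ())).symm
    · rw [insertVec_of_ne _ _ _ _ _ e]
      exact (key (Sum.inl ⟨i, e⟩)).symm
  comp_seq {A B C} _ _ _ a b {α β γ ω ζ ξ} p q r hq hr := by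
    ext v
    refine congrArg p ?_
    have key := pullVec_apply (k := k) 𝒱 (seqEquiv A B C a b) (graftColor_seq α a β b γ) v
    funext i
    by_cases e : i = a
    · subst e
      rw [insertVec_self, insertVec_self]
      refine congrArg _ (congrArg q ?_)
      funext j
      by_cases e' : j = b
      · subst e'
        refine (insertVec_self (k := k) 𝒱 (α := graftColor α i β) (Sum.inr j) hr _ _).trans ?_
        rw [insertVec_self]
        refine congrArg _ (congrArg r ?_)
        funext l
        exact (key (Sum.inr l)).symm
      · have h₁ : (Sum.inr j : Graft A i B) ≠ Sum.inr b := fun h => e' (Sum.inr.inj h)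
        refine (insertVec_of_ne (k := k) 𝒱 (α := graftColor α i β) (Sum.inr b) hr _ _ h₁).trans ?_
        rw [insertVec_of_ne _ _ _ _ _ e']
        exact (key (Sum.inl ⟨Sum.inr j, h₁⟩)).symm
    · rw [insertVec_of_ne _ _ _ _ _ e, insertVec_of_ne _ _ _ _ _ e]
      have h₁ : (Sum.inl ⟨i, e⟩ : Graft A a B) ≠ Sum.inr b := Sum.inl_ne_inr
      refine (insertVec_of_ne (k := k) 𝒱 (α := graftColor α a β) (Sum.inr b) hr _ _ h₁).trans ?_
      exact (key (Sum.inl ⟨Sum.inl ⟨i, e⟩, h₁⟩)).symm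
  comp_par {A B C} _ _ _ a a' hne {α β γ ω ζ ξ} p q r hq hr := by
    ext v
    refine congrArg p ?_
    have key := pullVec_apply (k := k) 𝒱 (parEquiv A B C a a' hne)
      (graftColor_par α a a' hne β γ) v
    have self₁ := insertVec_self (k := k) 𝒱 (α := graftColor α a β)
      (Sum.inl ⟨a', hne⟩ : Graft A a B) hr
    have self₂ := insertVec_self (k := k) 𝒱 (α := graftColor α a' γ)
      (Sum.inl ⟨a, hne.symm⟩ : Graft A a' C) hq
    have ne₁ := @insertVec_of_ne k _ Ω 𝒱 _ _ (Graft A a B) (Sum.inl ⟨a', hne⟩)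
      (graftColor α a β) ξ hr
    have ne₂ := @insertVec_of_ne k _ Ω 𝒱 _ _ (Graft A a' C) (Sum.inl ⟨a, hne.symm⟩)
      (graftColor α a' γ) ζ hq
    funext i
    by_cases e : i = a
    · subst e
      rw [insertVec_self, insertVec_of_ne _ _ _ _ _ hne.symm]
      refine Eq.trans ?_ (self₂ _ _).symm
      refine congrArg _ (congrArg q ?_)
      funext j
      refine (ne₁ _ _ (i := Sum.inr j) Sum.inr_ne_inl).trans ?_
      exact (key (Sum.inl ⟨Sum.inr j, Sum.inr_ne_inl⟩)).symm
    · by_cases e' : i = a'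
      · subst e'
        rw [insertVec_self, insertVec_of_ne _ _ _ _ _ e]
        refine (self₁ _ _).trans ?_
        refine congrArg _ (congrArg r ?_)
        funext l
        refine Eq.trans ?_ (ne₂ _ _ (i := Sum.inr l) Sum.inr_ne_inl).symm
        exact (key (Sum.inr l)).symm
      · rw [insertVec_of_ne _ _ _ _ _ e, insertVec_of_ne _ _ _ _ _ e']
        have h₁ : (Sum.inl ⟨i, e⟩ : Graft A a B) ≠ Sum.inl ⟨a', hne⟩ :=
          fun h => e' (congrArg Subtype.val (Sum.inl.inj h))
        have h₂ : (Sum.inl ⟨i, e'⟩ : Graft A a' C) ≠ Sum.inl ⟨a, hne.symm⟩ :=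
          fun h => e (congrArg Subtype.val (Sum.inl.inj h))
        refine (ne₁ _ _ h₁).trans (Eq.trans ?_ (ne₂ _ _ h₂).symm)
        exact (key (Sum.inl ⟨Sum.inl ⟨i, e⟩, h₁⟩)).symm
  map_add _ _ _ _ _ _ _ := rfl
  map_smul _ _ _ _ _ _ _ := rfl
  add_comp _ _ _ _ _ _ _ _ _ := rfl
  smul_comp _ _ _ _ _ _ _ _ _ := rfl
  comp_add a _ _ _ _ p q q' h := by
    classical
    ext v
    refine (congrArg p (insertVec_eq_update 𝒱 a h _ _)).trans ?_
    refine Eq.trans ?_ (congrArg₂ (· + ·) (congrArg p (insertVec_eq_update 𝒱 a h _ _))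
      (congrArg p (insertVec_eq_update 𝒱 a h _ _))).symm
    rw [← p.map_update_add, ← _root_.map_add]
    rfl
  comp_smul a _ _ _ _ c p q h := by
    classical
    ext v
    refine (congrArg p (insertVec_eq_update 𝒱 a h _ _)).trans ?_
    refine Eq.trans ?_ (congrArg (c • ·) (congrArg p (insertVec_eq_update 𝒱 a h _ _))).symm
    rw [← p.map_update_smul, ← _root_.map_smul]
    rfl

end endGraded

/-! ### Quotients of set operads and of linear operads -/

/-- An equivalence relation compatible with the structure of a set operad. -/
structure ColoredOperad.Congruence {Ω : Type w} (P : ColoredOperad.{w, v} Ω) where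
  r : ∀ (A : Type) [Finite A] (α : A → Ω) (ω : Ω), Setoid (P.obj A α ω)
  map_r : ∀ {A B : Type} [Finite A] [Finite B] (φ : A ≃ B) {α : A → Ω} {β : B → Ω} {ω : Ω}
    (h : ∀ i, α i = β (φ i)) (p p' : P.obj B β ω),
    (r B β ω) p p' → (r A α ω) (P.map φ h p) (P.map φ h p')
  comp_r : ∀ {A B : Type} [Finite A] [Finite B] (a : A) {α : A → Ω} {β : B → Ω} {ω ζ : Ω}
    (p p' : P.obj A α ω) (q q' : P.obj B β ζ) (h : ζ = α a),
    (r A α ω) p p' → (r B β ζ) q q' →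
    (r (Graft A a B) (graftColor α a β) ω) (P.comp a p q h) (P.comp a p' q' h)

/-- The finest compatible equivalence relation containing the relation `S`. -/
def ColoredOperad.congruenceGen {Ω : Type w} (P : ColoredOperad.{w, v} Ω)
    (S : ∀ (A : Type) [Finite A] (α : A → Ω) (ω : Ω), P.obj A α ω → P.obj A α ω → Prop) :
    P.Congruence where
  r A _ α ω := sInf {s | ∃ C : P.Congruence, (∀ (B : Type) [Finite B] (β : B → Ω) (ζ : Ω)
    (p q : P.obj B β ζ), S B β ζ p q → (C.r B β ζ) p q) ∧ s = C.r A α ω}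
  map_r := by
    rintro A B _ _ φ α β ω h p p' hp _ ⟨C, hC, rfl⟩
    exact C.map_r φ h p p' (hp (r := C.r B β ω) ⟨C, hC, rfl⟩)
  comp_r := by
    rintro A B _ _ a α β ω ζ p p' q q' h hp hq _ ⟨C, hC, rfl⟩
    exact C.comp_r a p p' q q' h (hp (r := C.r A α ω) ⟨C, hC, rfl⟩)
      (hq (r := C.r B β ζ) ⟨C, hC, rfl⟩)

/-- The quotient of a set operad by a compatible equivalence relation. -/
def ColoredOperad.quot {Ω : Type w} (P : ColoredOperad.{w, v} Ω) (C : P.Congruence) :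
    ColoredOperad.{w, v} Ω where
  obj A _ α ω := Quotient (C.r A α ω)
  map φ _ _ _ h := Quotient.map (P.map φ h) fun p p' => C.map_r φ h p p'
  one ω := Quotient.mk _ (P.one ω)
  comp a _ _ _ _ p q h := Quotient.map₂ (fun p q => P.comp a p q h)
    (fun p p' hp q q' hq => C.comp_r a p p' q q' h hp hq) p q
  map_refl p := by
    induction p using Quotient.ind
    exact congrArg _ (P.map_refl _)
  map_trans φ ψ _ _ _ _ hα hβ p := by
    induction p using Quotient.ind
    exact congrArg _ (P.map_trans φ ψ hα hβ _)
  comp_map φ ψ a _ _ _ _ _ _ hα hβ p q h := by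
    induction p using Quotient.ind
    induction q using Quotient.ind
    exact congrArg _ (P.comp_map φ ψ a hα hβ _ _ h)
  one_comp q := by
    induction q using Quotient.ind
    exact congrArg _ (P.one_comp _)
  comp_one a p := by
    induction p using Quotient.ind
    exact congrArg _ (P.comp_one a _)
  comp_seq a b _ _ _ _ _ _ p q r hq hr := by
    induction p using Quotient.ind
    induction q using Quotient.ind
    induction r using Quotient.ind
    exact congrArg _ (P.comp_seq a b _ _ _ hq hr)
  comp_par a a' hne _ _ _ _ _ _ p q r hq hr := by
    induction p using Quotient.ind
    induction q using Quotient.ind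
    induction r using Quotient.ind
    exact congrArg _ (P.comp_par a a' hne _ _ _ hq hr)

/-- A two-sided operadic ideal of a coloured linear operad. -/
structure LinOperad.Ideal {k : Type u} [Field k] {Ω : Type w} (P : LinOperad.{u, w, v} k Ω) where
  carrier : ∀ (A : Type) [Finite A] (α : A → Ω) (ω : Ω), Submodule k (P.obj A α ω)
  map_mem : ∀ {A B : Type} [Finite A] [Finite B] (φ : A ≃ B) {α : A → Ω} {β : B → Ω} {ω : Ω}
    (h : ∀ i, α i = β (φ i)) (p : P.obj B β ω),
    p ∈ carrier B β ω → P.map φ h p ∈ carrier A α ω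
  comp_mem_left : ∀ {A B : Type} [Finite A] [Finite B] (a : A) {α : A → Ω} {β : B → Ω} {ω ζ : Ω}
    (p : P.obj A α ω) (q : P.obj B β ζ) (h : ζ = α a), p ∈ carrier A α ω →
    P.comp a p q h ∈ carrier (Graft A a B) (graftColor α a β) ω
  comp_mem_right : ∀ {A B : Type} [Finite A] [Finite B] (a : A) {α : A → Ω} {β : B → Ω} {ω ζ : Ω}
    (p : P.obj A α ω) (q : P.obj B β ζ) (h : ζ = α a), q ∈ carrier B β ζ →
    P.comp a p q h ∈ carrier (Graft A a B) (graftColor α a β) ω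

/-- The smallest two-sided operadic ideal containing the collection `S`. -/
def LinOperad.idealGen {k : Type u} [Field k] {Ω : Type w} (P : LinOperad.{u, w, v} k Ω)
    (S : ∀ (A : Type) [Finite A] (α : A → Ω) (ω : Ω), Set (P.obj A α ω)) : P.Ideal where
  carrier A _ α ω := sInf {K | ∃ I : P.Ideal, (∀ (B : Type) [Finite B] (β : B → Ω) (ζ : Ω),
    S B β ζ ⊆ I.carrier B β ζ) ∧ K = I.carrier A α ω}
  map_mem := by
    intro A B _ _ φ α β ω h p hp
    rw [Submodule.mem_sInf] at hp ⊢
    rintro _ ⟨I, hI, rfl⟩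
    exact I.map_mem φ h p (hp _ ⟨I, hI, rfl⟩)
  comp_mem_left := by
    intro A B _ _ a α β ω ζ p q h hp
    rw [Submodule.mem_sInf] at hp ⊢
    rintro _ ⟨I, hI, rfl⟩
    exact I.comp_mem_left a p q h (hp _ ⟨I, hI, rfl⟩)
  comp_mem_right := by
    intro A B _ _ a α β ω ζ p q h hq
    rw [Submodule.mem_sInf] at hq ⊢
    rintro _ ⟨I, hI, rfl⟩
    exact I.comp_mem_right a p q h (hq _ ⟨I, hI, rfl⟩)

section linquot

variable {k : Type u} [Field k] {Ω : Type w} (P : LinOperad.{u, w, v} k Ω)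

/-- The action of a bijection as a linear map. -/
def LinOperad.mapL {A B : Type} [Finite A] [Finite B] (φ : A ≃ B) {α : A → Ω} {β : B → Ω} {ω : Ω}
    (h : ∀ i, α i = β (φ i)) : P.obj B β ω →ₗ[k] P.obj A α ω where
  toFun := P.map φ h
  map_add' := P.map_add φ h
  map_smul' := P.map_smul φ h

/-- The partial composition as a bilinear map. -/
def LinOperad.compL {A B : Type} [Finite A] [Finite B] (a : A) {α : A → Ω} {β : B → Ω} {ω ζ : Ω}
    (h : ζ = α a) :
    P.obj A α ω →ₗ[k] P.obj B β ζ →ₗ[k] P.obj (Graft A a B) (graftColor α a β) ω :=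
  LinearMap.mk₂ k (fun p q => P.comp a p q h) (fun p p' q => P.add_comp a p p' q h)
    (fun c p q => P.smul_comp a c p q h) (fun p q q' => P.comp_add a p q q' h)
    (fun c p q => P.comp_smul a c p q h)

/-- The quotient of a coloured linear operad by a two-sided operadic ideal. -/
def LinOperad.quot (I : P.Ideal) : LinOperad.{u, w, v} k Ω where
  obj A _ α ω := P.obj A α ω ⧸ I.carrier A α ω
  map φ α β ω h := (I.carrier _ β ω).mapQ (I.carrier _ α ω) (P.mapL φ h)
    fun p hp => I.map_mem φ h p hp
  one ω := Submodule.Quotient.mk (P.one ω)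
  comp a α β ω ζ p q h := Submodule.liftQ (I.carrier _ α ω)
    (LinearMap.flip (Submodule.liftQ (I.carrier _ β ζ)
      (LinearMap.flip ((P.compL a h).compr₂ (I.carrier _ (graftColor α a β) ω).mkQ))
      (fun q hq => by
        ext p
        exact (Submodule.Quotient.mk_eq_zero _).2 (I.comp_mem_right a p q h hq))))
    (fun p hp => by
      ext q
      exact (Submodule.Quotient.mk_eq_zero _).2 (I.comp_mem_left a p q h hp)) p q
  map_refl p := by
    induction p using Submodule.Quotient.induction_on
    exact congrArg _ (P.map_refl _)
  map_trans φ ψ _ _ _ _ hα hβ p := by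
    induction p using Submodule.Quotient.induction_on
    exact congrArg _ (P.map_trans φ ψ hα hβ _)
  comp_map φ ψ a _ _ _ _ _ _ hα hβ p q h := by
    induction p using Submodule.Quotient.induction_on
    induction q using Submodule.Quotient.induction_on
    exact congrArg _ (P.comp_map φ ψ a hα hβ _ _ h)
  one_comp q := by
    induction q using Submodule.Quotient.induction_on
    exact congrArg _ (P.one_comp _)
  comp_one a p := by
    induction p using Submodule.Quotient.induction_on
    exact congrArg _ (P.comp_one a _)
  comp_seq a b _ _ _ _ _ _ p q r hq hr := by
    induction p using Submodule.Quotient.induction_on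
    induction q using Submodule.Quotient.induction_on
    induction r using Submodule.Quotient.induction_on
    exact congrArg _ (P.comp_seq a b _ _ _ hq hr)
  comp_par a a' hne _ _ _ _ _ _ p q r hq hr := by
    induction p using Submodule.Quotient.induction_on
    induction q using Submodule.Quotient.induction_on
    induction r using Submodule.Quotient.induction_on
    exact congrArg _ (P.comp_par a a' hne _ _ _ hq hr)
  map_add _ _ _ _ _ _ _ := _root_.map_add _ _ _
  map_smul _ _ _ _ _ _ _ := _root_.map_smul _ _ _
  add_comp _ _ _ _ _ _ _ _ _ := by simp only [_root_.map_add, LinearMap.add_apply]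
  smul_comp _ _ _ _ _ _ _ _ _ := by simp only [_root_.map_smul, LinearMap.smul_apply]
  comp_add _ _ _ _ _ _ _ _ _ := _root_.map_add _ _ _
  comp_smul _ _ _ _ _ _ _ _ _ := _root_.map_smul _ _ _

/-- A linear suboperad of a coloured linear operad. -/
structure LinOperad.Sub where
  carrier : ∀ (A : Type) [Finite A] (α : A → Ω) (ω : Ω), Submodule k (P.obj A α ω)
  map_mem : ∀ {A B : Type} [Finite A] [Finite B] (φ : A ≃ B) {α : A → Ω} {β : B → Ω} {ω : Ω}
    (h : ∀ i, α i = β (φ i)) (p : P.obj B β ω),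
    p ∈ carrier B β ω → P.map φ h p ∈ carrier A α ω
  one_mem : ∀ ω : Ω, P.one ω ∈ carrier Unit (fun _ => ω) ω
  comp_mem : ∀ {A B : Type} [Finite A] [Finite B] (a : A) {α : A → Ω} {β : B → Ω} {ω ζ : Ω}
    (p : P.obj A α ω) (q : P.obj B β ζ) (h : ζ = α a), p ∈ carrier A α ω → q ∈ carrier B β ζ →
    P.comp a p q h ∈ carrier (Graft A a B) (graftColor α a β) ω

/-- A linear suboperad, as an operad. -/
def LinOperad.Sub.toOperad {P : LinOperad.{u, w, v} k Ω} (Q : P.Sub) : LinOperad.{u, w, v} k Ω where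
  obj A _ α ω := Q.carrier A α ω
  map φ _ _ _ h p := ⟨P.map φ h p.1, Q.map_mem φ h p.1 p.2⟩
  one ω := ⟨P.one ω, Q.one_mem ω⟩
  comp a _ _ _ _ p q h := ⟨P.comp a p.1 q.1 h, Q.comp_mem a p.1 q.1 h p.2 q.2⟩
  map_refl _ := Subtype.ext (P.map_refl _)
  map_trans φ ψ _ _ _ _ hα hβ _ := Subtype.ext (P.map_trans φ ψ hα hβ _)
  comp_map φ ψ a _ _ _ _ _ _ hα hβ _ _ h := Subtype.ext (P.comp_map φ ψ a hα hβ _ _ h)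
  one_comp _ := Subtype.ext (P.one_comp _)
  comp_one a _ := Subtype.ext (P.comp_one a _)
  comp_seq a b _ _ _ _ _ _ _ _ _ hq hr := Subtype.ext (P.comp_seq a b _ _ _ hq hr)
  comp_par a a' hne _ _ _ _ _ _ _ _ _ hq hr := Subtype.ext (P.comp_par a a' hne _ _ _ hq hr)
  map_add φ _ _ _ h _ _ := Subtype.ext (P.map_add φ h _ _)
  map_smul φ _ _ _ h _ _ := Subtype.ext (P.map_smul φ h _ _)
  add_comp a _ _ _ _ _ _ _ h := Subtype.ext (P.add_comp a _ _ _ h)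
  smul_comp a _ _ _ _ _ _ _ h := Subtype.ext (P.smul_comp a _ _ _ h)
  comp_add a _ _ _ _ _ _ _ h := Subtype.ext (P.comp_add a _ _ _ h)
  comp_smul a _ _ _ _ _ _ _ h := Subtype.ext (P.comp_smul a _ _ _ h)

end linquot

/-- The uniform `Ω`-coloured operad `P^Ω` of an ordinary operad `P`: the pull-back of `P` along
`Ω → {*}`, all of whose components `P^Ω_{A, α, ω}` are equal to `P_A`. -/
def LinOperad.uniform {k : Type u} [Field k] (P : LinOperad.{u, 0, v} k Unit) (Ω : Type w) :
    LinOperad.{u, w, v} k Ω where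
  obj A _ _ _ := P.obj A (fun _ => ()) ()
  map φ _ _ _ _ p := P.map φ (fun _ => rfl) p
  one _ := P.one ()
  comp a _ _ _ _ p q _ := P.comp a p q rfl
  map_refl := P.map_refl
  map_trans φ ψ _ _ _ _ _ _ p := P.map_trans φ ψ _ _ p
  comp_map φ ψ a _ _ _ _ _ _ _ _ p q _ := P.comp_map φ ψ a _ _ p q _
  one_comp := P.one_comp
  comp_one := P.comp_one
  comp_seq a b _ _ _ _ _ _ p q r _ _ := P.comp_seq a b p q r _ _
  comp_par a a' hne _ _ _ _ _ _ p q r _ _ := P.comp_par a a' hne p q r _ _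
  map_add φ _ _ _ _ := P.map_add φ _
  map_smul φ _ _ _ _ := P.map_smul φ _
  add_comp a _ _ _ _ p p' q _ := P.add_comp a p p' q _
  smul_comp a _ _ _ _ c p q _ := P.smul_comp a c p q _
  comp_add a _ _ _ _ p q q' _ := P.comp_add a p q q' _
  comp_smul a _ _ _ _ c p q _ := P.comp_smul a c p q _

/-! ### Linearization -/

/-- The bilinear extension of a map of sets. -/
def bilinExt (k : Type u) [Field k] {X : Type v₁} {Y : Type v₂} {Z : Type v₃} (f : X → Y → Z) :
    (X →₀ k) →ₗ[k] (Y →₀ k) →ₗ[k] (Z →₀ k) :=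
  Finsupp.linearCombination k fun p => Finsupp.lmapDomain k k (f p)

theorem bilinExt_single (k : Type u) [Field k] {X : Type v₁} {Y : Type v₂} {Z : Type v₃}
    (f : X → Y → Z) (p : X) (q : Y) (c d : k) :
    bilinExt k f (Finsupp.single p c) (Finsupp.single q d) = Finsupp.single (f p q) (c * d) := by
  simp [bilinExt, Finsupp.mapDomain_single]

/-- The linearization `k.P` of a set operad `P`. -/
def ColoredOperad.linearize (k : Type u) [Field k] {Ω : Type w} (P : ColoredOperad.{w, v} Ω) :
    LinOperad.{u, w, max u v} k Ω where
  obj A _ α ω := P.obj A α ω →₀ k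
  map φ _ _ _ h := Finsupp.mapDomain (P.map φ h)
  one ω := Finsupp.single (P.one ω) 1
  comp a _ _ _ _ p q h := bilinExt k (fun p q => P.comp a p q h) p q
  map_refl {A} _ {α ω} p := by
    have : P.map (Equiv.refl A) (fun _ => rfl) = (id : P.obj A α ω → P.obj A α ω) :=
      funext P.map_refl
    rw [this, Finsupp.mapDomain_id]
  map_trans φ ψ _ _ _ _ hα hβ p := by
    rw [← Finsupp.mapDomain_comp]
    exact congrArg (fun f => Finsupp.mapDomain f p) (funext (P.map_trans φ ψ hα hβ))
  comp_map φ ψ a _ _ _ _ _ _ hα hβ p q h := by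
    induction p using Finsupp.induction_linear with
    | zero => simp
    | add p p' hp hp' =>
      simp only [Finsupp.mapDomain_add, _root_.map_add, LinearMap.add_apply, hp, hp']
    | single p c =>
      induction q using Finsupp.induction_linear with
      | zero => simp
      | add q q' hq hq' => simp only [Finsupp.mapDomain_add, _root_.map_add, hq, hq']
      | single q d =>
        simp only [Finsupp.mapDomain_single, bilinExt_single]
        exact congrArg (Finsupp.single · _) (P.comp_map φ ψ a hα hβ p q h)
  one_comp q := by
    induction q using Finsupp.induction_linear with
    | zero => simp
    | add q q' hq hq' => simp only [Finsupp.mapDomain_add, _root_.map_add, hq, hq']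
    | single q d => simp only [Finsupp.mapDomain_single, bilinExt_single, P.one_comp, one_mul]
  comp_one a p := by
    induction p using Finsupp.induction_linear with
    | zero => simp
    | add p p' hp hp' =>
      simp only [Finsupp.mapDomain_add, _root_.map_add, LinearMap.add_apply, hp, hp']
    | single p c => simp only [Finsupp.mapDomain_single, bilinExt_single, P.comp_one, mul_one]
  comp_seq a b _ _ _ _ _ _ p q r hq hr := by
    induction p using Finsupp.induction_linear with
    | zero => simp
    | add p p' hp hp' =>
      simp only [Finsupp.mapDomain_add, _root_.map_add, LinearMap.add_apply, hp, hp']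
    | single p c =>
      induction q using Finsupp.induction_linear with
      | zero => simp
      | add q q' hq hq' =>
        simp only [Finsupp.mapDomain_add, _root_.map_add, LinearMap.add_apply, hq, hq']
      | single q d =>
        induction r using Finsupp.induction_linear with
        | zero => simp
        | add r r' hr hr' => simp only [Finsupp.mapDomain_add, _root_.map_add, hr, hr']
        | single r e =>
          simp only [Finsupp.mapDomain_single, bilinExt_single, P.comp_seq, mul_assoc]
  comp_par a a' hne _ _ _ _ _ _ p q r hq hr := by
    induction p using Finsupp.induction_linear with
    | zero => simp
    | add p p' hp hp' =>
      simp only [Finsupp.mapDomain_add, _root_.map_add, LinearMap.add_apply, hp, hp']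
    | single p c =>
      induction q using Finsupp.induction_linear with
      | zero => simp
      | add q q' hq hq' =>
        simp only [Finsupp.mapDomain_add, _root_.map_add, LinearMap.add_apply, hq, hq']
      | single q d =>
        induction r using Finsupp.induction_linear with
        | zero => simp
        | add r r' hr hr' =>
          simp only [Finsupp.mapDomain_add, _root_.map_add, LinearMap.add_apply, hr, hr']
        | single r e =>
          simp only [Finsupp.mapDomain_single, bilinExt_single, mul_right_comm c d e]
          rw [P.comp_par a a' hne p q r hq hr]
  map_add _ _ _ _ _ _ _ := Finsupp.mapDomain_add
  map_smul _ _ _ _ _ _ _ := Finsupp.mapDomain_smul _ _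
  add_comp _ _ _ _ _ _ _ _ _ := by simp only [_root_.map_add, LinearMap.add_apply]
  smul_comp _ _ _ _ _ _ _ _ _ := by simp only [_root_.map_smul, LinearMap.smul_apply]
  comp_add _ _ _ _ _ _ _ _ _ := _root_.map_add _ _ _
  comp_smul _ _ _ _ _ _ _ _ _ := _root_.map_smul _ _ _

/-! ### Free operads and presentations -/

/-- A (contravariant) set species. -/
structure SetSpecies where
  obj : (A : Type) → [Finite A] → Type v
  map : ∀ {A B : Type} [Finite A] [Finite B], (A ≃ B) → obj B → obj A
  map_refl : ∀ {A : Type} [Finite A] (e : obj A), map (Equiv.refl A) e = e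
  map_trans : ∀ {A B C : Type} [Finite A] [Finite B] [Finite C] (φ : A ≃ B) (ψ : B ≃ C)
    (e : obj C), map (φ.trans ψ) e = map φ (map ψ e)

/-- Formal expressions in generators, the unit, relabellings and partial compositions. -/
inductive OpExpr (E : SetSpecies.{v}) : Type → Type (max 1 v)
  | gen {A : Type} [Finite A] (e : E.obj A) : OpExpr E A
  | one : OpExpr E Unit
  | map {A B : Type} [Finite A] [Finite B] (φ : A ≃ B) (p : OpExpr E B) : OpExpr E A
  | comp {A B : Type} [Finite A] [Finite B] (a : A) (p : OpExpr E A) (q : OpExpr E B) :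
      OpExpr E (Graft A a B)

/-- The relation on formal expressions generated by the axioms of an operad and by functoriality of
the inclusion of the generators. -/
inductive OpExpr.Rel (E : SetSpecies.{v}) : ∀ {A : Type}, OpExpr E A → OpExpr E A → Prop
  | map_congr {A B : Type} [Finite A] [Finite B] (φ : A ≃ B) {p p' : OpExpr E B} :
      Rel E p p' → Rel E (.map φ p) (.map φ p')
  | comp_left {A B : Type} [Finite A] [Finite B] (a : A) {p p' : OpExpr E A} (q : OpExpr E B) :
      Rel E p p' → Rel E (.comp a p q) (.comp a p' q)
  | comp_right {A B : Type} [Finite A] [Finite B] (a : A) (p : OpExpr E A) {q q' : OpExpr E B} :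
      Rel E q q' → Rel E (.comp a p q) (.comp a p q')
  | map_gen {A B : Type} [Finite A] [Finite B] (φ : A ≃ B) (e : E.obj B) :
      Rel E (.map φ (.gen e)) (.gen (E.map φ e))
  | map_refl {A : Type} [Finite A] (p : OpExpr E A) : Rel E (.map (Equiv.refl A) p) p
  | map_trans {A B C : Type} [Finite A] [Finite B] [Finite C] (φ : A ≃ B) (ψ : B ≃ C)
      (p : OpExpr E C) : Rel E (.map (φ.trans ψ) p) (.map φ (.map ψ p))
  | comp_map {A A' B B' : Type} [Finite A] [Finite A'] [Finite B] [Finite B'] (φ : A' ≃ A)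
      (ψ : B' ≃ B) (a : A') (p : OpExpr E A) (q : OpExpr E B) :
      Rel E (.comp a (.map φ p) (.map ψ q)) (.map (graftEquiv φ ψ a) (.comp (φ a) p q))
  | one_comp {B : Type} [Finite B] (q : OpExpr E B) :
      Rel E (.comp () .one q) (.map (unitGraft B) q)
  | comp_one {A : Type} [Finite A] (a : A) (p : OpExpr E A) :
      Rel E (.comp a p .one) (.map (graftUnit A a) p)
  | comp_seq {A B C : Type} [Finite A] [Finite B] [Finite C] (a : A) (b : B) (p : OpExpr E A)
      (q : OpExpr E B) (r : OpExpr E C) :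
      Rel E (.comp (Sum.inr b) (.comp a p q) r)
        (.map (seqEquiv A B C a b) (.comp a p (.comp b q r)))
  | comp_par {A B C : Type} [Finite A] [Finite B] [Finite C] (a a' : A) (h : a' ≠ a)
      (p : OpExpr E A) (q : OpExpr E B) (r : OpExpr E C) :
      Rel E (.comp (Sum.inl ⟨a', h⟩) (.comp a p q) r)
        (.map (parEquiv A B C a a' h) (.comp (Sum.inl ⟨a, h.symm⟩) (.comp a' p r) q))

/-- The free set operad `𝐌_E` generated by a set species `E`. -/
def freeOperad (E : SetSpecies.{v}) : ColoredOperad.{0, max 1 v} Unit where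
  obj A _ _ _ := Quot (@OpExpr.Rel E A)
  map φ _ _ _ _ := Quot.map (OpExpr.map φ) fun _ _ => OpExpr.Rel.map_congr φ
  one _ := Quot.mk _ OpExpr.one
  comp a _ _ _ _ p q _ := Quot.map₂ (OpExpr.comp a) (fun p _ _ => OpExpr.Rel.comp_right a p)
    (fun _ _ q => OpExpr.Rel.comp_left a q) p q
  map_refl p := by
    induction p using Quot.ind
    exact Quot.sound (OpExpr.Rel.map_refl _)
  map_trans φ ψ _ _ _ _ _ _ p := by
    induction p using Quot.ind
    exact Quot.sound (OpExpr.Rel.map_trans φ ψ _)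
  comp_map φ ψ a _ _ _ _ _ _ _ _ p q _ := by
    induction p using Quot.ind
    induction q using Quot.ind
    exact Quot.sound (OpExpr.Rel.comp_map φ ψ a _ _)
  one_comp q := by
    induction q using Quot.ind
    exact Quot.sound (OpExpr.Rel.one_comp _)
  comp_one a p := by
    induction p using Quot.ind
    exact Quot.sound (OpExpr.Rel.comp_one a _)
  comp_seq a b _ _ _ _ _ _ p q r _ _ := by
    induction p using Quot.ind
    induction q using Quot.ind
    induction r using Quot.ind
    exact Quot.sound (OpExpr.Rel.comp_seq a b _ _ _)
  comp_par a a' hne _ _ _ _ _ _ p q r _ _ := by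
    induction p using Quot.ind
    induction q using Quot.ind
    induction r using Quot.ind
    exact Quot.sound (OpExpr.Rel.comp_par a a' hne _ _ _)

/-- A presentation with finitely many relations: a set species `E` of generators and finitely many
elements `μ¹, …, μᴺ` of the free linear operad `k.𝐌_E`, of respective arities `A₁, …, A_N`.  The
monomials of `μⁱ` are the elements of its support. -/
structure Presentation (k : Type u) [Field k] where
  gen : SetSpecies.{v}
  N : ℕ
  arity : Fin N → Type
  [finite_arity : ∀ i, Finite (arity i)]
  rel : ∀ i, (freeOperad gen).obj (arity i) (fun _ => ()) () →₀ k

attribute [instance] Presentation.finite_arity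

namespace Presentation

variable {k : Type u} [Field k] (𝔓 : Presentation.{u, v} k)

/-- The monomials `(𝐌_E)_A`. -/
abbrev Mon (A : Type) [Finite A] : Type (max 1 v) := (freeOperad 𝔓.gen).obj A (fun _ => ()) ()

/-- The free linear operad `ℳ_E = k.𝐌_E`. -/
def freeLin : LinOperad.{u, 0, max u 1 v} k Unit := (freeOperad 𝔓.gen).linearize k

/-- A monomial, as an element of `ℳ_E`. -/
def mono {A : Type} [Finite A] (μ : 𝔓.Mon A) : 𝔓.freeLin.obj A (fun _ => ()) () :=
  (Finsupp.single μ 1 : 𝔓.Mon A →₀ k)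

/-- The relations `μⁱ`, as a predicate on elements of `ℳ_E`. -/
inductive IsRel : (A : Type) → [Finite A] → 𝔓.freeLin.obj A (fun _ => ()) () → Prop
  | mk (i : Fin 𝔓.N) : IsRel (𝔓.arity i) (𝔓.rel i)

/-- The operadic ideal `ℛ` of `ℳ_E` generated by the relations. -/
def relIdeal : 𝔓.freeLin.Ideal :=
  𝔓.freeLin.idealGen fun A _ _ _ => {p | 𝔓.IsRel A p}

/-- The linear operad `𝒫 = ℳ_E / ℛ`. -/
def operad : LinOperad.{u, 0, max u 1 v} k Unit := 𝔓.freeLin.quot 𝔓.relIdeal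

/-- The projection `π : ℳ_E → 𝒫`. -/
def proj (A : Type) [Finite A] :
    𝔓.freeLin.obj A (fun _ => ()) () →ₗ[k] 𝔓.operad.obj A (fun _ => ()) () :=
  (𝔓.relIdeal.carrier A (fun _ => ()) ()).mkQ

/-- The projection `π : ℳ_E^Ω → 𝒫^Ω`. -/
def projUniform (Ω : Type w) (A : Type) [Finite A] (α : A → Ω) (ω : Ω) :
    (𝔓.freeLin.uniform Ω).obj A α ω →ₗ[k] (𝔓.operad.uniform Ω).obj A α ω :=
  𝔓.proj A

/-- The class in `𝒫` of a monomial. -/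
def projMon {A : Type} [Finite A] (μ : 𝔓.Mon A) : 𝔓.operad.obj A (fun _ => ()) () :=
  𝔓.proj A (𝔓.mono μ)

/-- Two monomials are related if they both occur in one of the relations `μⁱ`. -/
inductive MonRel : (A : Type) → [Finite A] → 𝔓.Mon A → 𝔓.Mon A → Prop
  | mk (i : Fin 𝔓.N) (p q : 𝔓.Mon (𝔓.arity i)) :
      𝔓.rel i p ≠ 0 → 𝔓.rel i q ≠ 0 → MonRel (𝔓.arity i) p q

/-- The set operadic equivalence relation generated by the relations: the finest equivalence
relation on `𝐌_E`, compatible with the operad structure, such that any two monomials of the same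
relation are equivalent. -/
def setCongruence : (freeOperad 𝔓.gen).Congruence :=
  (freeOperad 𝔓.gen).congruenceGen fun A _ _ _ p q => 𝔓.MonRel A p q

/-- The set operad `Ⓟ` associated to the presented linear operad `𝒫`. -/
def setOperad : ColoredOperad.{0, max 1 v} Unit := (freeOperad 𝔓.gen).quot 𝔓.setCongruence

/-- A structure of algebra over the set operad `Ⓟ` on the set `Ω`. -/
abbrev SetAlgebra (Ω : Type w) : Type (max 1 v w) := ColoredOperad.Hom 𝔓.setOperad (endSet Ω)

variable {𝔓} {Ω : Type w} (ρ : 𝔓.SetAlgebra Ω)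

/-- The element `μ(α)` of the `Ⓟ`-algebra `Ω`, for a monomial `μ ∈ (𝐌_E)_A` and `α ∈ Ω^A`. -/
def SetAlgebra.eval {A : Type} [Finite A] (μ : 𝔓.Mon A) (α : A → Ω) : Ω :=
  ρ.app A (fun _ => ()) () (Quotient.mk (𝔓.setCongruence.r A (fun _ => ()) ()) μ) α

theorem SetAlgebra.eval_map {A B : Type} [Finite A] [Finite B] (φ : A ≃ B) (μ : 𝔓.Mon B)
    {α : A → Ω} {β : B → Ω} (h : ∀ i, α i = β (φ i)) :
    ρ.eval ((freeOperad 𝔓.gen).map φ (fun _ => rfl) μ) α = ρ.eval μ β := by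
  obtain rfl : α = β ∘ φ := funext h
  refine (congrFun (ρ.app_map φ (α := fun _ => ()) (fun _ => rfl)
    (Quotient.mk (𝔓.setCongruence.r B (fun _ => ()) ()) μ)) (β ∘ φ)).trans ?_
  change ρ.eval μ ((β ∘ φ) ∘ φ.symm) = _
  congr 1
  funext j
  simp

theorem SetAlgebra.eval_one (ω : Ω) : ρ.eval ((freeOperad 𝔓.gen).one ()) (fun _ => ω) = ω :=
  congrFun (ρ.app_one ()) _

theorem SetAlgebra.eval_comp {A B : Type} [Finite A] [Finite B] (a : A) (μ : 𝔓.Mon A)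
    (ν : 𝔓.Mon B) (α : A → Ω) (β : B → Ω) (h : ρ.eval ν β = α a) :
    ρ.eval ((freeOperad 𝔓.gen).comp a μ ν rfl) (graftColor α a β) = ρ.eval μ α := by
  refine (congrFun (ρ.app_comp a (Quotient.mk (𝔓.setCongruence.r A (fun _ => ()) ()) μ)
    (Quotient.mk (𝔓.setCongruence.r B (fun _ => ()) ()) ν) rfl) (graftColor α a β)).trans ?_
  refine congrArg (ρ.eval μ) ?_
  funext i
  by_cases e : i = a
  · subst e
    simp only [dite_true]
    exact h
  · simp [e]

/-- `(ℳ̃_E^Ω)_{A, α, ω}`: the span of the monomials `μ` with `μ(α) = ω`. -/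
def SetAlgebra.goodMon (A : Type) [Finite A] (α : A → Ω) (ω : Ω) :
    Submodule k ((𝔓.freeLin.uniform Ω).obj A α ω) :=
  Submodule.span k {p | ∃ μ : 𝔓.Mon A, ρ.eval μ α = ω ∧ p = 𝔓.mono μ}

/-- `ℐ_{A, α, ω}`: the span of the monomials `μ` with `μ(α) ≠ ω`. -/
def SetAlgebra.badMon (A : Type) [Finite A] (α : A → Ω) (ω : Ω) :
    Submodule k ((𝔓.freeLin.uniform Ω).obj A α ω) :=
  Submodule.span k {p | ∃ μ : 𝔓.Mon A, ρ.eval μ α ≠ ω ∧ p = 𝔓.mono μ}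

/-- The two-sided coloured operadic ideal `𝒥` of `ℳ_E^Ω` generated by `ℐ`. -/
def SetAlgebra.badIdeal : (𝔓.freeLin.uniform Ω).Ideal :=
  (𝔓.freeLin.uniform Ω).idealGen fun A _ α ω => (ρ.badMon A α ω : Set _)

theorem SetAlgebra.goodMon_map {A B : Type} [Finite A] [Finite B] (φ : A ≃ B) {α : A → Ω}
    {β : B → Ω} {ω : Ω} (h : ∀ i, α i = β (φ i)) (p : (𝔓.freeLin.uniform Ω).obj B β ω)
    (hp : p ∈ ρ.goodMon B β ω) : (𝔓.freeLin.uniform Ω).map φ h p ∈ ρ.goodMon A α ω := by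
  change (𝔓.freeLin.uniform Ω).mapL φ h p ∈ _
  induction hp using Submodule.span_induction with
  | mem p hp =>
    obtain ⟨μ, hμ, rfl⟩ := hp
    exact Submodule.subset_span ⟨_, (ρ.eval_map φ μ h).trans hμ, Finsupp.mapDomain_single⟩
  | zero => rw [_root_.map_zero]; exact Submodule.zero_mem _
  | add p q _ _ hp hq => rw [_root_.map_add]; exact Submodule.add_mem _ hp hq
  | smul c p _ hp => rw [_root_.map_smul]; exact Submodule.smul_mem _ c hp

theorem SetAlgebra.goodMon_comp {A B : Type} [Finite A] [Finite B] (a : A) {α : A → Ω}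
    {β : B → Ω} {ω ζ : Ω} (p : (𝔓.freeLin.uniform Ω).obj A α ω)
    (q : (𝔓.freeLin.uniform Ω).obj B β ζ) (h : ζ = α a)
    (hp : p ∈ ρ.goodMon A α ω) (hq : q ∈ ρ.goodMon B β ζ) :
    (𝔓.freeLin.uniform Ω).comp a p q h ∈ ρ.goodMon (Graft A a B) (graftColor α a β) ω := by
  change (𝔓.freeLin.uniform Ω).compL a h p q ∈ _
  induction hp using Submodule.span_induction with
  | mem p hp =>
    obtain ⟨μ, hμ, rfl⟩ := hp
    induction hq using Submodule.span_induction with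
    | mem q hq =>
      obtain ⟨ν, hν, rfl⟩ := hq
      refine Submodule.subset_span
        ⟨_, (ρ.eval_comp a μ ν α β (hν.trans h)).trans hμ, ?_⟩
      refine (bilinExt_single k _ _ _ _ _).trans ?_
      rw [one_mul]
      rfl
    | zero => rw [_root_.map_zero]; exact Submodule.zero_mem _
    | add p q _ _ hp hq => rw [_root_.map_add]; exact Submodule.add_mem _ hp hq
    | smul c p _ hp => rw [_root_.map_smul]; exact Submodule.smul_mem _ c hp
  | zero => rw [_root_.map_zero]; exact Submodule.zero_mem _
  | add p q _ _ hp hq => rw [_root_.map_add]; exact Submodule.add_mem _ hp hq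
  | smul c p _ hp => rw [_root_.map_smul]; exact Submodule.smul_mem _ c hp

/-- The coloured suboperad `𝒫̃^Ω = π(ℳ̃_E^Ω)` of `𝒫^Ω`. -/
def SetAlgebra.colorSub : (𝔓.operad.uniform Ω).Sub where
  carrier A _ α ω := (ρ.goodMon A α ω).map (𝔓.projUniform Ω A α ω)
  map_mem := by
    rintro A B _ _ φ α β ω h _ ⟨p, hp, rfl⟩
    exact ⟨_, ρ.goodMon_map φ h p hp, rfl⟩
  one_mem ω := ⟨𝔓.mono ((freeOperad 𝔓.gen).one ()),
    Submodule.subset_span ⟨_, ρ.eval_one ω, rfl⟩, rfl⟩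
  comp_mem := by
    rintro A B _ _ a α β ω ζ _ _ h ⟨p, hp, rfl⟩ ⟨q, hq, rfl⟩
    exact ⟨_, ρ.goodMon_comp a p q h hp hq, rfl⟩

/-- The class of a monomial `μ`, as an element of `𝒫̃^Ω_{A, α, μ(α)}`. -/
def SetAlgebra.subMon {A : Type} [Finite A] (μ : 𝔓.Mon A) (α : A → Ω) :
    ρ.colorSub.toOperad.obj A α (ρ.eval μ α) :=
  ⟨𝔓.projMon μ, 𝔓.mono μ, Submodule.subset_span ⟨μ, rfl, rfl⟩, rfl⟩

/-- The image `π(𝒥)`, a two-sided coloured operadic ideal of `𝒫^Ω`. -/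
def SetAlgebra.imageIdeal : (𝔓.operad.uniform Ω).Ideal where
  carrier A _ α ω := (ρ.badIdeal.carrier A α ω).map (𝔓.projUniform Ω A α ω)
  map_mem := by
    rintro A B _ _ φ α β ω h _ ⟨p, hp, rfl⟩
    exact ⟨_, ρ.badIdeal.map_mem φ h p hp, rfl⟩
  comp_mem_left := by
    rintro A B _ _ a α β ω ζ _ q h ⟨p, hp, rfl⟩
    obtain ⟨q, rfl⟩ := Submodule.mkQ_surjective _ q
    exact ⟨_, ρ.badIdeal.comp_mem_left a p q h hp, rfl⟩
  comp_mem_right := by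
    rintro A B _ _ a α β ω ζ p _ h ⟨q, hq, rfl⟩
    obtain ⟨p, rfl⟩ := Submodule.mkQ_surjective _ p
    exact ⟨_, ρ.badIdeal.comp_mem_right a p q h hq, rfl⟩

/-- The color-mixing operad `𝒫^Ω / π(𝒥)`. -/
def SetAlgebra.colorMixing : LinOperad.{u, w, max u 1 v} k Ω :=
  (𝔓.operad.uniform Ω).quot ρ.imageIdeal

/-- The projection `𝒫 = 𝒫^Ω_{A, α, ω} → (𝒫^Ω / π(𝒥))_{A, α, ω}`. -/
def SetAlgebra.mixProj {A : Type} [Finite A] (α : A → Ω) (ω : Ω) :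
    𝔓.operad.obj A (fun _ => ()) () →ₗ[k] ρ.colorMixing.obj A α ω :=
  (ρ.imageIdeal.carrier A α ω).mkQ

end Presentation

/-! ### Algebras -/

/-- A structure of algebra over the ordinary linear operad `P` on the vector space `W`. -/
abbrev LinOperad.Algebra {k : Type u} [Field k] (P : LinOperad.{u, 0, v} k Unit) (W : Type x)
    [AddCommGroup W] [Module k W] : Type (max 1 v x) :=
  P.Hom (endGraded k fun _ : Unit => W)

/-- A structure of algebra over the `Ω`-coloured linear operad `P` on the `Ω`-graded vector space
`𝒱`. -/
abbrev LinOperad.GradedAlgebra {k : Type u} [Field k] {Ω : Type w} (P : LinOperad.{u, w, v} k Ω)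
    (𝒱 : Ω → Type x) [∀ ω, AddCommGroup (𝒱 ω)] [∀ ω, Module k (𝒱 ω)] : Type (max 1 v w x) :=
  P.Hom (endGraded k 𝒱)

/-- The multilinear operation on `W` given by an element of `P`. -/
def LinOperad.Hom.act {k : Type u} [Field k] {P : LinOperad.{u, 0, v} k Unit} {W : Type x}
    [AddCommGroup W] [Module k W] (Ψ : P.Algebra W) {A : Type} [Finite A]
    (p : P.obj A (fun _ => ()) ()) : MultilinearMap k (fun _ : A => W) W :=
  Ψ.app A (fun _ => ()) () p

/-- The multilinear operation of colour `(A, α, ω)` on the uniform graded vector space `𝒰(V)`,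
`𝒰(V)_ω = V`, given by an element of `P`. -/
def LinOperad.Hom.uniformAct {k : Type u} [Field k] {Ω : Type w} {P : LinOperad.{u, w, v} k Ω}
    {V : Type x} [AddCommGroup V] [Module k V] (Φ : P.GradedAlgebra fun _ : Ω => V) {A : Type}
    [Finite A] {α : A → Ω} {ω : Ω} (p : P.obj A α ω) : MultilinearMap k (fun _ : A => V) V :=
  Φ.app A α ω p

namespace Presentation

variable {k : Type u} [Field k] {𝔓 : Presentation.{u, v} k} {Ω : Type w} (ρ : 𝔓.SetAlgebra Ω)

/-- `Ω`-graded `𝒫`-algebras. -/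
abbrev SetAlgebra.GradedAlgebra (𝒱 : Ω → Type x) [∀ ω, AddCommGroup (𝒱 ω)]
    [∀ ω, Module k (𝒱 ω)] : Type (max 1 u v w x) :=
  ρ.colorMixing.GradedAlgebra 𝒱

/-- `Ω`-family `𝒫`-algebras: `Ω`-graded `𝒫`-algebras whose underlying graded vector space is the
uniform one, `𝒰(V)`. -/
abbrev SetAlgebra.FamilyAlgebra (V : Type x) [AddCommGroup V] [Module k V] :
    Type (max 1 u v w x) :=
  ρ.GradedAlgebra fun _ : Ω => V

end Presentation

/-! ### The completed forgetful functor -/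

namespace LinOperad

variable {k : Type u} [Field k] {Ω : Type w} (Q : LinOperad.{u, w, v} k Ω)

/-- `(ℱ̄ Q)_A = ∏_{(α, ω)} Q_{A, α, ω}`. -/
abbrev Completed (A : Type) [Finite A] : Type (max v w) := ∀ c : (A → Ω) × Ω, Q.obj A c.1 c.2

variable {Q}

/-- The action of bijections on `ℱ̄ Q`. -/
def completedMap {A B : Type} [Finite A] [Finite B] (φ : A ≃ B) (p : Q.Completed B) :
    Q.Completed A := fun c =>
  Q.map φ (fun i => by simp) (p (c.1 ∘ φ.symm, c.2))

variable (Q) in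
open Classical in
/-- The unit of `ℱ̄ Q`: the family of all units of `Q`. -/
def completedOne : Q.Completed Unit := fun c =>
  if h : c.1 () = c.2 then Q.map (Equiv.refl Unit) (fun _ => h) (Q.one c.2) else 0

open Classical in
/-- The colouring of `A` which agrees with `γ` on `A \ {a}` and has value `ζ` at `a`. -/
def insertColor {A B : Type} (a : A) (γ : Graft A a B → Ω) (ζ : Ω) (i : A) : Ω :=
  if h : i = a then ζ else γ (Sum.inl ⟨i, h⟩)

theorem insertColor_self {A B : Type} (a : A) (γ : Graft A a B → Ω) (ζ : Ω) :
    ζ = insertColor a γ ζ a := by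
  simp [insertColor]

theorem graftColor_insertColor {A B : Type} (a : A) (γ : Graft A a B → Ω) (ζ : Ω) :
    ∀ i, γ i = graftColor (insertColor a γ ζ) a (γ ∘ Sum.inr) (Equiv.refl _ i) := by
  rintro (⟨i, hi⟩ | j)
  · simp [insertColor, hi]
  · rfl

/-- The contribution of the intermediate colour `ζ` to the component of colour `c` of the partial
composition of two elements of `ℱ̄ Q`. -/
def completedCompTerm {A B : Type} [Finite A] [Finite B] (a : A) (p : Q.Completed A)
    (q : Q.Completed B) (c : (Graft A a B → Ω) × Ω) (ζ : Ω) : Q.obj (Graft A a B) c.1 c.2 :=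
  Q.map (Equiv.refl _) (graftColor_insertColor a c.1 ζ)
    (Q.comp a (p (insertColor a c.1 ζ, c.2)) (q (c.1 ∘ Sum.inr, ζ)) (insertColor_self a c.1 ζ))

variable (Q) in
/-- An identification of the ordinary operad `F` with the completed forgetful image `ℱ̄ Q`: the
spaces of `F` are the products of all components of `Q`, with componentwise action of bijections and
unit, and partial compositions are computed by summing over the intermediate colour, all these sums
being finite. -/
structure CompletedForget (F : LinOperad.{u, 0, v₁} k Unit) where
  equiv : ∀ (A : Type) [Finite A], F.obj A (fun _ => ()) () ≃ₗ[k] Q.Completed A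
  equiv_map : ∀ {A B : Type} [Finite A] [Finite B] (φ : A ≃ B) (p : F.obj B (fun _ => ()) ()),
    equiv A (F.map φ (fun _ => rfl) p) = completedMap φ (equiv B p)
  equiv_one : equiv Unit (F.one ()) = Q.completedOne
  finite_comp : ∀ {A B : Type} [Finite A] [Finite B] (a : A) (p : F.obj A (fun _ => ()) ())
    (q : F.obj B (fun _ => ()) ()) (c : (Graft A a B → Ω) × Ω),
    (Function.support (completedCompTerm a (equiv A p) (equiv B q) c)).Finite
  equiv_comp : ∀ {A B : Type} [Finite A] [Finite B] (a : A) (p : F.obj A (fun _ => ()) ())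
    (q : F.obj B (fun _ => ()) ()) (c : (Graft A a B → Ω) × Ω),
    equiv (Graft A a B) (F.comp a p q rfl) c =
      ∑ᶠ ζ : Ω, completedCompTerm a (equiv A p) (equiv B q) c ζ

variable (Q) in
open Classical in
/-- The inclusion of `Q_{A, α, ω}` in `(ℱ̄ Q)_A`. -/
def completedSingle {A : Type} [Finite A] (α : A → Ω) (ω : Ω) (p : Q.obj A α ω) :
    Q.Completed A :=
  Pi.single (M := fun c : (A → Ω) × Ω => Q.obj A c.1 c.2) (α, ω) p

end LinOperad

end

end FamilyAlg

open FamilyAlg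

/-!
The first two assertions are one construction.  Let `Φ` be an algebra over `𝒫̃^Ω` on `𝒰(V)`.  Since
`V ⊗ kΩ` is the direct sum of copies `V ⊗ ω` of `V`, a multilinear map on it is the same as a family
of multilinear maps on `V` indexed by the colourings `α` of the arguments (`assemble`,
`multilinear_ext_colored`).  A monomial `μ` thus acts on `V ⊗ kΩ` by
`⨂ (v_a ⊗ α_a) ↦ Φ(π(μ))(v) ⊗ μ(α)`.  This is a morphism of set operads from `𝐌_E` (`monHom`),
because `Φ` is a morphism and the colours compose in `Ω` as the monomials do; it extends linearly to
`ℳ_E`.  An element of `ℳ_E` all of whose monomials have the same value `ω` at `α` acts, on vectors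
of colours `α`, through `Φ` of its class in `𝒫̃^Ω_{A, α, ω}` (`freeAlgebra_colored`).  The monomials
of a defining relation are equivalent for `Ⓡ`, hence have the same value at every `α`, so the
relation acts through its class in `𝒫`, which is zero (`freeAlgebra_rel`).  Therefore the action
descends to `𝒫`.  Uniqueness holds because the classes of the monomials span `𝒫` and the vectors
`v ⊗ ω` span `V ⊗ kΩ` (`existsUnique_tensorAlgebra`).  An algebra over the color-mixing operad is
pulled back to `𝒫̃^Ω` along `𝒫̃^Ω → 𝒫^Ω → 𝒫^Ω / π(𝒥)`, and the assertion about it is a special case.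

The third assertion depends on the size of the ideal `𝒥`.  If `Ω` has two distinct elements
`ω' ≠ ω`, the identity monomial, seen in colour `ω' → ω`, belongs to `ℐ`; composing it with an
arbitrary element of output colour `ω'` gives the same element with output colour `ω`, so that `𝒥`
is all of `ℳ_E^Ω` (`mem_badIdeal`) and the color-mixing operad vanishes.  In particular a family
algebra then has `V = 0`.  If `Ω` is a point, there is just one colour.  In both cases all
components of the color-mixing operad outside one chosen colour `ω₀` are zero
(`colorMixing_concentratedIn`); hence the product of all components is the component of colour
`ω₀`, the sums over intermediate colours have at most one non-zero term, and the restrictions of the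
operad and of its algebra to the colour `ω₀` are the required ones (`concentratedForget`).  This
collapse is essential: for finite `Ω` the unit of the completed operad is the sum of the units of
all colours, each of which acts on `V` as the identity, so it would act as multiplication by the
number of colours.
-/

namespace FamilyAlg

noncomputable section

/-! ### Universal properties of linearizations and quotients -/

section universal

variable {k : Type u} [Field k] {Ω : Type w}

namespace LinOperad

/-- The composition of two morphisms of coloured linear operads. -/
def Hom.trans {P : LinOperad.{u, w, v₁} k Ω} {Q : LinOperad.{u, w, v₂} k Ω}
    {R : LinOperad.{u, w, v₃} k Ω} (f : P.Hom Q) (g : Q.Hom R) : P.Hom R where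
  app A _ α ω p := g.app A α ω (f.app A α ω p)
  app_map φ _ _ _ h p := by rw [f.app_map, g.app_map]
  app_one ω := by rw [f.app_one, g.app_one]
  app_comp a _ _ _ _ p q h := by rw [f.app_comp, g.app_comp]
  app_add p q := by rw [f.app_add, g.app_add]
  app_smul c p := by rw [f.app_smul, g.app_smul]

/-- A component of a morphism of coloured linear operads, as a linear map. -/
def Hom.appL {P : LinOperad.{u, w, v₁} k Ω} {Q : LinOperad.{u, w, v₂} k Ω} (f : P.Hom Q)
    (A : Type) [Finite A] (α : A → Ω) (ω : Ω) : P.obj A α ω →ₗ[k] Q.obj A α ω where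
  toFun := f.app A α ω
  map_add' := f.app_add
  map_smul' := f.app_smul

/-- The inclusion of a suboperad. -/
def Sub.incl {P : LinOperad.{u, w, v} k Ω} (S : P.Sub) : S.toOperad.Hom P where
  app _ _ _ _ p := p.1
  app_map _ _ _ _ _ _ := rfl
  app_one _ := rfl
  app_comp _ _ _ _ _ _ _ _ := rfl
  app_add _ _ := rfl
  app_smul _ _ := rfl

/-- The projection onto a quotient operad. -/
def quotMk (P : LinOperad.{u, w, v} k Ω) (I : P.Ideal) : P.Hom (P.quot I) where
  app A _ α ω p := (I.carrier A α ω).mkQ p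
  app_map _ _ _ _ _ _ := rfl
  app_one _ := rfl
  app_comp _ _ _ _ _ _ _ _ := rfl
  app_add p q := _root_.map_add _ p q
  app_smul c p := _root_.map_smul _ c p

/-- The kernel of a morphism, a two-sided operadic ideal. -/
def Hom.ker {P : LinOperad.{u, w, v₁} k Ω} {Q : LinOperad.{u, w, v₂} k Ω} (f : P.Hom Q) :
    P.Ideal where
  carrier A _ α ω := LinearMap.ker (f.appL A α ω)
  map_mem φ α β ω h p hp := by
    rw [LinearMap.mem_ker] at hp ⊢
    exact (f.app_map φ h p).trans ((congrArg (Q.mapL φ h) hp).trans (_root_.map_zero _))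
  comp_mem_left a α β ω ζ p q h hp := by
    rw [LinearMap.mem_ker] at hp ⊢
    refine (f.app_comp a p q h).trans
      ((congrArg (fun p' => Q.compL a h p' (f.app _ β ζ q)) hp).trans ?_)
    simp
  comp_mem_right a α β ω ζ p q h hq := by
    rw [LinearMap.mem_ker] at hq ⊢
    exact (f.app_comp a p q h).trans
      ((congrArg (Q.compL a h (f.app _ α ω p)) hq).trans (_root_.map_zero _))

theorem subset_idealGen (P : LinOperad.{u, w, v} k Ω)
    (S : ∀ (A : Type) [Finite A] (α : A → Ω) (ω : Ω), Set (P.obj A α ω))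
    {A : Type} [Finite A] {α : A → Ω} {ω : Ω} :
    S A α ω ⊆ (P.idealGen S).carrier A α ω := by
  intro p hp
  refine Submodule.mem_sInf.2 ?_
  rintro _ ⟨I, hI, rfl⟩
  exact hI A α ω hp

theorem idealGen_le (P : LinOperad.{u, w, v} k Ω)
    (S : ∀ (A : Type) [Finite A] (α : A → Ω) (ω : Ω), Set (P.obj A α ω)) (I : P.Ideal)
    (hI : ∀ (A : Type) [Finite A] (α : A → Ω) (ω : Ω), S A α ω ⊆ I.carrier A α ω)
    (A : Type) [Finite A] (α : A → Ω) (ω : Ω) :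
    (P.idealGen S).carrier A α ω ≤ I.carrier A α ω :=
  sInf_le ⟨I, hI, rfl⟩

/-- The universal property of a quotient operad. -/
def Hom.quotLift {P : LinOperad.{u, w, v₁} k Ω} {Q : LinOperad.{u, w, v₂} k Ω} (f : P.Hom Q)
    (I : P.Ideal)
    (hI : ∀ (A : Type) [Finite A] (α : A → Ω) (ω : Ω), I.carrier A α ω ≤ f.ker.carrier A α ω) :
    (P.quot I).Hom Q where
  app A _ α ω := (I.carrier A α ω).liftQ (f.appL A α ω) (hI A α ω)
  app_map φ _ _ _ h p := by
    induction p using Submodule.Quotient.induction_on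
    exact f.app_map φ h _
  app_one ω := f.app_one ω
  app_comp a _ _ _ _ p q h := by
    induction p using Submodule.Quotient.induction_on
    induction q using Submodule.Quotient.induction_on
    exact f.app_comp a _ _ h
  app_add p q := _root_.map_add _ p q
  app_smul c p := _root_.map_smul _ c p

end LinOperad

/-- The universal property of the linearization of a set operad. -/
def ColoredOperad.Hom.linearizeLift {P : ColoredOperad.{w, v₁} Ω} {Q : LinOperad.{u, w, v₂} k Ω}
    (f : P.Hom Q.toColoredOperad) : (P.linearize k).Hom Q where
  app A _ α ω := Finsupp.linearCombination k (f.app A α ω)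
  app_map {A B} _ _ φ α β ω h := by
    -- The components of `P.linearize k` are spaces of finitely supported functions only up to
    -- unfolding; the claim is restated so that lemmas about `Finsupp` apply.
    suffices key : ∀ p : P.obj B β ω →₀ k,
        Finsupp.linearCombination k (f.app A α ω) (Finsupp.mapDomain (P.map φ h) p) =
          Q.mapL φ h (Finsupp.linearCombination k (f.app B β ω) p) from key
    intro p
    rw [Finsupp.linearCombination_mapDomain, Finsupp.apply_linearCombination]
    exact congrArg (fun g => Finsupp.linearCombination k g p) (funext (f.app_map φ h))
  app_one ω := by
    refine (Finsupp.linearCombination_single k _ _).trans ?_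
    rw [one_smul]
    exact f.app_one ω
  app_comp {A B} _ _ a α β ω ζ := by
    suffices key : ∀ (p : P.obj A α ω →₀ k) (q : P.obj B β ζ →₀ k) (h : ζ = α a),
        Finsupp.linearCombination k (f.app _ (graftColor α a β) ω)
            (bilinExt k (fun p q => P.comp a p q h) p q) =
          Q.compL a h (Finsupp.linearCombination k (f.app A α ω) p)
            (Finsupp.linearCombination k (f.app B β ζ) q) from key
    intro p q h
    induction p using Finsupp.induction_linear with
    | zero => simp
    | add p p' hp hp' => simp only [_root_.map_add, LinearMap.add_apply, hp, hp']
    | single p c =>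
      induction q using Finsupp.induction_linear with
      | zero => simp
      | add q q' hq hq' => simp only [_root_.map_add, hq, hq']
      | single q d =>
        simp only [bilinExt_single, Finsupp.linearCombination_single, _root_.map_smul,
          LinearMap.smul_apply, mul_smul]
        rw [smul_comm c d]
        exact congrArg (fun z => d • c • z) (f.app_comp a p q h)
  app_add p q := _root_.map_add _ p q
  app_smul c p := _root_.map_smul _ c p

theorem ColoredOperad.Hom.linearizeLift_single {P : ColoredOperad.{w, v₁} Ω}
    {Q : LinOperad.{u, w, v₂} k Ω} (f : P.Hom Q.toColoredOperad) {A : Type} [Finite A] {α : A → Ω}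
    {ω : Ω} (p : P.obj A α ω) :
    (f.linearizeLift (k := k)).app A α ω (Finsupp.single p 1 : P.obj A α ω →₀ k) =
      f.app A α ω p :=
  (Finsupp.linearCombination_single k _ _).trans (one_smul k _)

theorem eq_of_mem_span {M N : Type*} [AddCommGroup M] [Module k M] [AddCommGroup N] [Module k N]
    {S : Set M} (f : M →ₗ[k] N) (g : Submodule.span k S →ₗ[k] N)
    (h : ∀ (x : M) (hx : x ∈ S), f x = g ⟨x, Submodule.subset_span hx⟩) (x : M)
    (hx : x ∈ Submodule.span k S) : f x = g ⟨x, hx⟩ := by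
  induction hx using Submodule.span_induction with
  | mem x hx => exact h x hx
  | zero => exact (_root_.map_zero f).trans (_root_.map_zero g).symm
  | add x y hx hy ihx ihy =>
    rw [_root_.map_add, ihx, ihy, ← _root_.map_add]
    rfl
  | smul c x hx ih =>
    rw [_root_.map_smul, ih, ← _root_.map_smul]
    rfl

end universal

/-! ### Endomorphisms of a uniform graded vector space -/

section uniform

variable {k : Type u} [Field k] {Ω : Type w} {V : Type x} [AddCommGroup V] [Module k V]

theorem degCast_const {ω ω' : Ω} (h : ω = ω') (v : V) :
    degCast (k := k) (fun _ : Ω => V) h v = v := by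
  cases h; rfl

variable {A B : Type} [Finite A] [Finite B]

/-- The elements of the endomorphism operad of `𝒰(V)`, as multilinear operations on `V`. -/
def endOp {α : A → Ω} {ω : Ω} (f : (endGraded k fun _ : Ω => V).obj A α ω) :
    MultilinearMap k (fun _ : A => V) V := f

theorem endOp_map (φ : A ≃ B) {α : A → Ω} {β : B → Ω} {ω : Ω} (h : ∀ i, α i = β (φ i))
    (f : (endGraded k fun _ : Ω => V).obj B β ω) (v : A → V) :
    endOp ((endGraded k fun _ : Ω => V).map φ h f) v = endOp f (v ∘ φ.symm) := by
  refine congrArg (endOp f) (funext fun j => ?_)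
  exact degCast_const _ _

open Classical in
theorem endOp_comp (a : A) {α : A → Ω} {β : B → Ω} {ω ζ : Ω}
    (f : (endGraded k fun _ : Ω => V).obj A α ω) (g : (endGraded k fun _ : Ω => V).obj B β ζ)
    (h : ζ = α a) (v : Graft A a B → V) :
    endOp ((endGraded k fun _ : Ω => V).comp a f g h) v =
      endOp f fun i =>
        if e : i = a then endOp g fun j => v (Sum.inr j) else v (Sum.inl ⟨i, e⟩) := by
  refine congrArg (endOp f) (funext fun i => ?_)
  by_cases e : i = a
  · subst e
    simp only [dite_true]
    exact (insertVec_self (k := k) (fun _ : Ω => V) i h _ _).trans (degCast_const _ _)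
  · simp only [e, dite_false]
    exact insertVec_of_ne (k := k) (fun _ : Ω => V) a h _ _ e

end uniform

section act

variable {k : Type u} [Field k] {Ω : Type w} {V : Type x} [AddCommGroup V] [Module k V]
  {A : Type} [Finite A]

/-- The value at `v` of the operation of an element of `P`, as a linear function of the element. -/
def LinOperad.Hom.uniformActAt {P : LinOperad.{u, w, v} k Ω}
    (Φ : P.GradedAlgebra fun _ : Ω => V) (α : A → Ω) (ω : Ω) (v : A → V) :
    P.obj A α ω →ₗ[k] V where
  toFun p := Φ.uniformAct p v
  map_add' p q := congrArg (fun f => endOp f v) (Φ.app_add p q)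
  map_smul' c p := congrArg (fun f => endOp f v) (Φ.app_smul c p)

/-- The value at `v` of the operation of an element of `P`, as a linear function of the element. -/
def LinOperad.Hom.actAt {P : LinOperad.{u, 0, v} k Unit} (Ψ : P.Algebra V) (v : A → V) :
    P.obj A (fun _ => ()) () →ₗ[k] V :=
  Ψ.uniformActAt _ _ v

end act

/-! ### Multilinear maps on `V ⊗ kΩ` -/

section multilinear

variable {k : Type u} [Field k] {Ω : Type w} {V : Type x} [AddCommGroup V] [Module k V]
  {N : Type*} [AddCommGroup N] [Module k N] {A : Type} [Finite A]

variable (k) in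
/-- The vector `v ⊗ ω` of `V ⊗ kΩ`, as a linear function of `v`. -/
def colored (ω : Ω) : V →ₗ[k] V ⊗[k] (Ω →₀ k) :=
  (TensorProduct.mk k V (Ω →₀ k)).flip (Finsupp.single ω 1)

theorem colored_apply (ω : Ω) (v : V) :
    colored k ω v = v ⊗ₜ[k] Finsupp.single ω (1 : k) := rfl

variable (k V Ω) in
open Classical in
/-- The decomposition of `V ⊗ kΩ` as the direct sum of copies of `V` indexed by `Ω`. -/
def coloredEquiv : V ⊗[k] (Ω →₀ k) ≃ₗ[k] Π₀ _ : Ω, V :=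
  TensorProduct.finsuppScalarRight k k V Ω ≪≫ₗ finsuppLequivDFinsupp k

open Classical in
theorem coloredEquiv_colored (ω : Ω) (v : V) :
    coloredEquiv k Ω V (colored k ω v) = DFinsupp.single ω v := by
  rw [coloredEquiv, LinearEquiv.trans_apply, colored_apply,
    TensorProduct.finsuppScalarRight_apply_tmul, Finsupp.sum_single_index (by simp), one_smul]
  exact Finsupp.toDFinsupp_single _ _

open Classical in
/-- The multilinear map on `V ⊗ kΩ` given, for all colourings `α` of its arguments, by a multilinear
map `g α` on `V`. -/
def assemble (g : (A → Ω) → MultilinearMap k (fun _ : A => V) N) :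
    MultilinearMap k (fun _ : A => V ⊗[k] (Ω →₀ k)) N :=
  letI := Fintype.ofFinite A
  (MultilinearMap.fromDFinsuppEquiv (fun _ : A => Ω) k g).compLinearMap
    fun _ => (coloredEquiv k Ω V).toLinearMap

theorem assemble_colored (g : (A → Ω) → MultilinearMap k (fun _ : A => V) N) (α : A → Ω)
    (v : A → V) : assemble g (fun a => colored k (α a) (v a)) = g α v := by
  classical
  simp only [assemble, MultilinearMap.compLinearMap_apply, LinearEquiv.coe_coe,
    coloredEquiv_colored]
  let := Fintype.ofFinite A
  exact MultilinearMap.fromDFinsuppEquiv_single (κ := fun _ : A => Ω) (R := k)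
    (M := fun _ _ => V) g α v

theorem multilinear_ext_colored
    {f g : MultilinearMap k (fun _ : A => V ⊗[k] (Ω →₀ k)) N}
    (h : ∀ (α : A → Ω) (v : A → V),
      f (fun a => colored k (α a) (v a)) = g fun a => colored k (α a) (v a)) : f = g := by
  classical
  have key : f.compLinearMap (fun _ => (coloredEquiv k Ω V).symm.toLinearMap) =
      g.compLinearMap fun _ => (coloredEquiv k Ω V).symm.toLinearMap := by
    refine MultilinearMap.dfinsupp_ext fun α => MultilinearMap.ext fun v => ?_
    have e : ∀ a, (coloredEquiv k Ω V).symm (DFinsupp.single (α a) (v a)) =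
        colored k (α a) (v a) := fun a => by
      rw [LinearEquiv.symm_apply_eq, coloredEquiv_colored]
    simpa [e] using h α v
  refine MultilinearMap.ext fun x => ?_
  have := congrArg (fun F => F fun a => coloredEquiv k Ω V (x a)) key
  simpa using this

end multilinear

/-! ### The `𝒫`-algebra `V ⊗ kΩ` -/

namespace Presentation

variable {k : Type u} [Field k] {𝔓 : Presentation.{u, v} k} {Ω : Type w} (ρ : 𝔓.SetAlgebra Ω)
  {V : Type x} [AddCommGroup V] [Module k V]

/-- The class of a monomial `μ` with `μ(α) = ω`, as an element of `𝒫̃^Ω_{A, α, ω}`. -/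
def SetAlgebra.subMonOf {A : Type} [Finite A] (μ : 𝔓.Mon A) {α : A → Ω} {ω : Ω}
    (h : ρ.eval μ α = ω) : ρ.colorSub.toOperad.obj A α ω :=
  ⟨𝔓.projMon μ, 𝔓.mono μ, Submodule.subset_span ⟨μ, h, rfl⟩, rfl⟩

theorem SetAlgebra.subMonOf_map {A B : Type} [Finite A] [Finite B] (φ : A ≃ B) (μ : 𝔓.Mon B)
    {α : A → Ω} {β : B → Ω} {ω : Ω} (h : ∀ i, α i = β (φ i)) (hμ : ρ.eval μ β = ω) :
    ρ.subMonOf ((freeOperad 𝔓.gen).map φ (fun _ => rfl) μ) ((ρ.eval_map φ μ h).trans hμ) =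
      ρ.colorSub.toOperad.map φ h (ρ.subMonOf μ hμ) :=
  Subtype.ext (congrArg (𝔓.proj A) Finsupp.mapDomain_single.symm)

theorem SetAlgebra.subMonOf_comp {A B : Type} [Finite A] [Finite B] (a : A) (μ : 𝔓.Mon A)
    (ν : 𝔓.Mon B) {α : A → Ω} {β : B → Ω} {ω ζ : Ω} (hμ : ρ.eval μ α = ω)
    (hν : ρ.eval ν β = ζ) (h : ζ = α a) :
    ρ.subMonOf ((freeOperad 𝔓.gen).comp a μ ν rfl)
        ((ρ.eval_comp a μ ν α β (hν.trans h)).trans hμ) =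
      ρ.colorSub.toOperad.comp a (ρ.subMonOf μ hμ) (ρ.subMonOf ν hν) h := by
  refine Subtype.ext (congrArg (𝔓.proj (Graft A a B)) ?_)
  refine Eq.trans ?_ (bilinExt_single k _ μ ν 1 1).symm
  rw [one_mul]
  rfl

variable {ρ} (Φ : ρ.colorSub.toOperad.GradedAlgebra (fun _ : Ω => V))

/-- The operation of a monomial `μ` on `V ⊗ kΩ`. -/
def monAct {A : Type} [Finite A] (μ : 𝔓.Mon A) :
    MultilinearMap k (fun _ : A => V ⊗[k] (Ω →₀ k)) (V ⊗[k] (Ω →₀ k)) :=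
  assemble fun α => (colored k (ρ.eval μ α)).compMultilinearMap (Φ.uniformAct (ρ.subMon μ α))

theorem monAct_colored {A : Type} [Finite A] (μ : 𝔓.Mon A) {α : A → Ω} {ω : Ω}
    (h : ρ.eval μ α = ω) (v : A → V) :
    monAct Φ μ (fun a => colored k (α a) (v a)) =
      colored k ω (Φ.uniformAct (ρ.subMonOf μ h) v) := by
  subst h
  exact assemble_colored _ α v

/-- The operations of the monomials on `V ⊗ kΩ` are compatible with the operad structures. -/
def monHom : (freeOperad 𝔓.gen).Hom
    (endGraded k fun _ : Unit => V ⊗[k] (Ω →₀ k)).toColoredOperad where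
  app A _ _ _ μ := monAct Φ μ
  app_map {A B} _ _ φ _ _ _ _ μ := by
    refine multilinear_ext_colored fun α v => ?_
    have h : ∀ i, α i = (α ∘ φ.symm) (φ i) := fun i => by simp
    refine (monAct_colored Φ _ (ρ.eval_map φ μ h) v).trans ?_
    refine Eq.trans ?_ (endOp_map φ _ (monAct Φ μ) _).symm
    refine Eq.trans ?_ (monAct_colored Φ μ rfl (v ∘ φ.symm)).symm
    refine congrArg _ ?_
    refine Eq.trans ?_ (endOp_map φ h (Φ.app B (α ∘ φ.symm) _ (ρ.subMonOf μ rfl)) v)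
    exact congrArg (fun f => endOp f v)
      ((congrArg (Φ.app A α _) (ρ.subMonOf_map φ μ h rfl)).trans (Φ.app_map φ h _))
  app_one _ := by
    refine multilinear_ext_colored fun α v => ?_
    refine (monAct_colored Φ _ (ρ.eval_one (α ())) v).trans ?_
    refine congrArg (colored k (α ())) ?_
    exact congrArg (fun f => endOp f v) (Φ.app_one (α ()))
  app_comp {A B} _ _ a _ _ _ _ μ ν _ := by
    classical
    refine multilinear_ext_colored fun γ v => ?_
    -- The vectors inserted at `a` are values of `ν`, so their colour is that of `ν` at `γ ∘ inr`.
    obtain ⟨α, β, rfl, h⟩ : ∃ (α : A → Ω) (β : B → Ω), γ = graftColor α a β ∧ ρ.eval ν β = α a :=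
      ⟨LinOperad.insertColor a γ (ρ.eval ν (γ ∘ Sum.inr)), γ ∘ Sum.inr,
        funext (LinOperad.graftColor_insertColor a γ _), LinOperad.insertColor_self a γ _⟩
    refine (monAct_colored Φ _ (ρ.eval_comp a μ ν α β h) v).trans ?_
    refine Eq.trans ?_ (endOp_comp a (monAct Φ μ) (monAct Φ ν) rfl _).symm
    have key : (fun i => if e : i = a then
          monAct Φ ν fun j => colored k (graftColor α a β (Sum.inr j)) (v (Sum.inr j))
        else colored k (graftColor α a β (Sum.inl ⟨i, e⟩)) (v (Sum.inl ⟨i, e⟩))) =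
        fun i => colored k (α i) (if e : i = a then
          Φ.uniformAct (ρ.subMonOf ν (α := β) rfl) fun j => v (Sum.inr j)
        else v (Sum.inl ⟨i, e⟩)) := by
      funext i
      by_cases e : i = a
      · subst e
        simp only [dite_true]
        rw [← h]
        exact monAct_colored Φ ν rfl _
      · simp only [e, dite_false]
    refine Eq.trans ?_ (congrArg (monAct Φ μ) key).symm
    refine Eq.trans ?_ (monAct_colored Φ μ rfl _).symm
    refine congrArg _ ?_
    refine Eq.trans ?_ (endOp_comp a (Φ.app A α _ (ρ.subMonOf μ rfl))
      (Φ.app B β _ (ρ.subMonOf ν rfl)) h v)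
    exact congrArg (fun f => endOp f v)
      ((congrArg (Φ.app _ (graftColor α a β) _) (ρ.subMonOf_comp a μ ν rfl rfl h)).trans
        (Φ.app_comp a _ _ h))

/-- The `ℳ_E`-algebra structure on `V ⊗ kΩ`. -/
def freeAlgebra : 𝔓.freeLin.Algebra (V ⊗[k] (Ω →₀ k)) := (monHom Φ).linearizeLift

theorem freeAlgebra_mono {A : Type} [Finite A] (μ : 𝔓.Mon A) :
    (freeAlgebra Φ).act (𝔓.mono μ) = monAct Φ μ :=
  (monHom Φ).linearizeLift_single μ

/-- On vectors of colours `α`, an element of `ℳ_E` all of whose monomials have value `ω` at `α` acts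
through its class in `𝒫̃^Ω_{A, α, ω}`. -/
theorem freeAlgebra_colored {A : Type} [Finite A] {α : A → Ω} {ω : Ω}
    (p : 𝔓.freeLin.obj A (fun _ => ()) ()) (hp : p ∈ ρ.goodMon A α ω) (v : A → V) :
    (freeAlgebra Φ).act p (fun a => colored k (α a) (v a)) =
      colored k ω (Φ.uniformAct ⟨𝔓.proj A p, p, hp, rfl⟩ v) := by
  refine eq_of_mem_span ((freeAlgebra Φ).actAt fun a => colored k (α a) (v a))
    (colored k ω ∘ₗ Φ.uniformActAt α ω v ∘ₗ
      (𝔓.projUniform Ω A α ω).submoduleMap (ρ.goodMon A α ω)) ?_ p hp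
  rintro _ ⟨μ, hμ, rfl⟩
  exact (DFunLike.congr_fun (freeAlgebra_mono Φ μ) _).trans (monAct_colored Φ μ hμ v)

theorem eval_eq_of_monRel (ρ : 𝔓.SetAlgebra Ω) {A : Type} [Finite A] {μ ν : 𝔓.Mon A}
    (h : 𝔓.MonRel A μ ν) (α : A → Ω) : ρ.eval μ α = ρ.eval ν α := by
  have h' : (𝔓.setCongruence.r A (fun _ => ()) ()) μ ν := by
    rintro _ ⟨C, hC, rfl⟩
    exact hC A _ _ _ _ h
  exact congrFun (congrArg (ρ.app A (fun _ => ()) ()) (Quotient.sound h')) α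

theorem mem_goodMon (ρ : 𝔓.SetAlgebra Ω) {A : Type} [Finite A] (p : 𝔓.Mon A →₀ k) {α : A → Ω}
    {ω : Ω} (hp : ∀ μ, p μ ≠ 0 → ρ.eval μ α = ω) :
    (p : 𝔓.freeLin.obj A (fun _ => ()) ()) ∈ ρ.goodMon A α ω := by
  suffices key : ∀ K : Submodule k (𝔓.Mon A →₀ k),
      (∀ μ, ρ.eval μ α = ω → Finsupp.single μ 1 ∈ K) → p ∈ K from
    key (ρ.goodMon A α ω) fun μ hμ =>
      (Submodule.subset_span ⟨μ, hμ, rfl⟩ : 𝔓.mono μ ∈ ρ.goodMon A α ω)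
  intro K hK
  rw [← Finsupp.sum_single p]
  refine Submodule.sum_mem _ fun μ hμ => ?_
  rw [← mul_one (p μ), ← smul_eq_mul, ← Finsupp.smul_single]
  exact K.smul_mem _ (hK μ (hp μ (Finsupp.mem_support_iff.1 hμ)))

theorem freeLin_linearMap_ext {A : Type} [Finite A] {N : Type*} [AddCommGroup N] [Module k N]
    {f g : 𝔓.freeLin.obj A (fun _ => ()) () →ₗ[k] N} (h : ∀ μ, f (𝔓.mono μ) = g (𝔓.mono μ)) :
    f = g := by
  suffices key : ∀ f g : (𝔓.Mon A →₀ k) →ₗ[k] N,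
      (∀ μ, f (Finsupp.single μ 1) = g (Finsupp.single μ 1)) → f = g from key f g h
  exact fun f g h => Finsupp.lhom_ext' fun μ => LinearMap.ext_ring (h μ)

/-- The defining relations of `𝒫` act by zero on `V ⊗ kΩ`: by definition of `Ⓟ`, all monomials of a
relation have the same value `ω` at a colouring `α`, so the relation acts on vectors of colours `α`
through its class in `𝒫̃^Ω_{A, α, ω}`, which vanishes. -/
theorem freeAlgebra_rel {A : Type} [Finite A] {p : 𝔓.freeLin.obj A (fun _ => ()) ()}
    (hp : 𝔓.IsRel A p) : (freeAlgebra Φ).act p = 0 := by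
  have hmem : 𝔓.proj A p = 0 :=
    (Submodule.Quotient.mk_eq_zero _).2 (𝔓.freeLin.subset_idealGen _ (α := fun _ => ()) hp)
  obtain ⟨i⟩ := hp
  by_cases hi : 𝔓.rel i = 0
  · rw [hi]
    exact _root_.map_zero ((freeAlgebra Φ).appL _ (fun _ => ()) ())
  obtain ⟨μ, hμ⟩ := Finsupp.ne_iff.1 hi
  refine multilinear_ext_colored fun α v => ?_
  have hgood := mem_goodMon ρ (𝔓.rel i) (α := α) (ω := ρ.eval μ α)
    fun ν hν => (eval_eq_of_monRel ρ (.mk i μ ν hμ hν) α).symm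
  refine (freeAlgebra_colored Φ _ hgood v).trans ?_
  have e : (⟨𝔓.proj _ (𝔓.rel i), 𝔓.rel i, hgood, rfl⟩ :
      ρ.colorSub.toOperad.obj _ α (ρ.eval μ α)) = 0 := Subtype.ext hmem
  exact (congrArg (colored k (ρ.eval μ α) ∘ₗ Φ.uniformActAt α _ v) e).trans (_root_.map_zero _)

/-- The `𝒫`-algebra structure on `V ⊗ kΩ`. -/
def tensorAlgebra : 𝔓.operad.Algebra (V ⊗[k] (Ω →₀ k)) :=
  (freeAlgebra Φ).quotLift 𝔓.relIdeal
    (𝔓.freeLin.idealGen_le _ _ fun _ _ _ _ _ hp => freeAlgebra_rel Φ hp)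

theorem tensorAlgebra_projMon {A : Type} [Finite A] (μ : 𝔓.Mon A) :
    (tensorAlgebra Φ).act (𝔓.projMon μ) = monAct Φ μ :=
  freeAlgebra_mono Φ μ

/-- A `𝒫`-algebra structure is determined by the operations of the monomials. -/
theorem algebra_ext {W : Type x} [AddCommGroup W] [Module k W] {Ψ Ψ' : 𝔓.operad.Algebra W}
    (h : ∀ (A : Type) [Finite A] (μ : 𝔓.Mon A),
      Ψ.act (𝔓.projMon μ) = Ψ'.act (𝔓.projMon μ)) : Ψ = Ψ' := by
  have key : Ψ.app = Ψ'.app := by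
    funext A _ α ω p
    obtain ⟨p, rfl⟩ := Submodule.mkQ_surjective _ p
    exact LinearMap.congr_fun (freeLin_linearMap_ext (f := Ψ.appL A α ω ∘ₗ 𝔓.proj A)
      (g := Ψ'.appL A α ω ∘ₗ 𝔓.proj A) fun μ => h A μ) p
  obtain ⟨⟨f, _, _, _⟩, _, _⟩ := Ψ
  obtain ⟨⟨g, _, _, _⟩, _, _⟩ := Ψ'
  obtain rfl : @f = @g := key
  rfl

theorem existsUnique_tensorAlgebra :
    ∃! Ψ : 𝔓.operad.Algebra (V ⊗[k] (Ω →₀ k)),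
      ∀ (A : Type) [Finite A] (μ : 𝔓.Mon A) (α : A → Ω) (v : A → V),
        Ψ.act (𝔓.projMon μ) (fun a => v a ⊗ₜ[k] Finsupp.single (α a) (1 : k)) =
          Φ.uniformAct (ρ.subMon μ α) v ⊗ₜ[k] Finsupp.single (ρ.eval μ α) (1 : k) := by
  refine ⟨tensorAlgebra Φ, fun A _ μ α v => ?_, fun Ψ hΨ => algebra_ext fun A _ μ => ?_⟩
  · rw [tensorAlgebra_projMon]
    exact monAct_colored Φ μ rfl v
  · rw [tensorAlgebra_projMon]
    exact multilinear_ext_colored fun α v =>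
      (hΨ A μ α v).trans (monAct_colored Φ μ rfl v).symm

end Presentation

/-! ### Change of colours -/

namespace LinOperad

variable {k : Type u} [Field k] {Ω : Type w}

section relabel

variable (Q : LinOperad.{u, w, v} k Ω) {A A' B B' C : Type} [Finite A] [Finite A'] [Finite B]
  [Finite B'] [Finite C]

theorem map_congr {φ ψ : A ≃ B} (e : φ = ψ) {α : A → Ω} {β : B → Ω} {ω : Ω}
    (h : ∀ i, α i = β (φ i)) (h' : ∀ i, α i = β (ψ i)) (p : Q.obj B β ω) :
    Q.map φ h p = Q.map ψ h' p := by
  subst e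
  rfl

theorem map_comp_left (φ : A' ≃ A) (a : A') {α : A → Ω} {α' : A' → Ω} {β : B → Ω} {ω ζ : Ω}
    (hα : ∀ i, α' i = α (φ i)) (p : Q.obj A α ω) (q : Q.obj B β ζ) (h : ζ = α (φ a))
    (h' : ζ = α' a) :
    Q.comp a (Q.map φ hα p) q h' = Q.map (graftEquiv φ (Equiv.refl B) a)
      (graftColor_graftEquiv φ (Equiv.refl B) a hα fun _ => rfl) (Q.comp (φ a) p q h) := by
  have e := Q.comp_map φ (Equiv.refl B) a hα (fun _ => rfl) p q h
  rwa [Q.map_refl] at e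

theorem map_comp_right (ψ : B' ≃ B) (a : A) {α : A → Ω} {β : B → Ω} {β' : B' → Ω} {ω ζ : Ω}
    (hβ : ∀ i, β' i = β (ψ i)) (p : Q.obj A α ω) (q : Q.obj B β ζ) (h : ζ = α a) :
    Q.comp a p (Q.map ψ hβ q) h = Q.map (graftEquiv (Equiv.refl A) ψ a)
      (graftColor_graftEquiv (Equiv.refl A) ψ a (fun _ => rfl) hβ) (Q.comp a p q h) := by
  have e := Q.comp_map (Equiv.refl A) ψ a (fun _ => rfl) hβ p q h
  rwa [Q.map_refl] at e

end relabel

variable {Ω' : Type v₁} (f : Ω' → Ω)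

theorem comp_graftColor {A B : Type} (α : A → Ω') (a : A) (β : B → Ω') (i : Graft A a B) :
    f (graftColor α a β i) = graftColor (f ∘ α) a (f ∘ β) (Equiv.refl _ i) := by
  rcases i with i | j <;> rfl

/-- The pull-back of a coloured operad along a map of colours.  The colourings `f ∘ (α ⊔ₐ β)` and
`(f ∘ α) ⊔ₐ (f ∘ β)` agree pointwise only, and are identified by the action of the identity. -/
def pullback (Q : LinOperad.{u, w, v} k Ω) : LinOperad.{u, v₁, v} k Ω' where
  obj A _ α ω := Q.obj A (f ∘ α) (f ω)
  map φ _ _ _ h := Q.map φ fun i => congrArg f (h i)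
  one ω := Q.one (f ω)
  comp a _ _ _ _ p q h := Q.map (Equiv.refl _) (comp_graftColor f _ a _)
    (Q.comp a p q (congrArg f h))
  map_refl p := Q.map_refl p
  map_trans φ ψ _ _ _ _ _ _ p := Q.map_trans φ ψ _ _ p
  comp_map φ ψ a _ _ _ _ _ _ hα hβ p q h := by
    have e := Q.comp_map φ ψ a (fun i => congrArg f (hα i)) (fun j => congrArg f (hβ j)) p q
      (congrArg f h)
    refine (congrArg _ e).trans ?_
    exact (Q.map_trans _ _ _ _ _).symm.trans
      (Q.map_trans (graftEquiv φ ψ a) (Equiv.refl _) _ _ _)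
  one_comp q := by
    refine (congrArg _ (Q.one_comp q)).trans ?_
    exact (Q.map_trans _ _ _ _ _).symm
  comp_one a p := by
    refine (congrArg _ (Q.comp_one a p)).trans ?_
    exact (Q.map_trans _ _ _ _ _).symm
  comp_seq {A B C} _ _ _ a b α β γ _ _ _ p q r hq hr := by
    have e₁ := Q.map_comp_left (Equiv.refl _) (Sum.inr b : Graft A a B) (comp_graftColor f α a β)
      (Q.comp a p q (congrArg f hq)) r (congrArg f hr) (congrArg f hr)
    have e₂ := Q.map_comp_right (Equiv.refl _) a (comp_graftColor f β b γ) p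
      (Q.comp b q r (congrArg f hr)) (congrArg f hq)
    refine (congrArg _ e₁).trans (Eq.trans ?_ (congrArg _ (congrArg _ e₂)).symm)
    have e₃ := Q.comp_seq a b p q r (congrArg f hq) (congrArg f hr)
    refine (congrArg _ (congrArg _ e₃)).trans ?_
    refine (congrArg _ (Q.map_trans _ _ _ _ _).symm).trans ((Q.map_trans _ _ _ _ _).symm.trans ?_)
    refine Eq.trans ?_ (congrArg _ (Q.map_trans _ _ _ _ _))
    refine Eq.trans ?_ (Q.map_trans _ _ _ _ _)
    refine Q.map_congr (Equiv.ext ?_) _ _ _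
    rintro (⟨i | j, h⟩ | l) <;> rfl
  comp_par {A B C} _ _ _ a a' hne α β γ _ _ _ p q r hq hr := by
    have e₁ := Q.map_comp_left (Equiv.refl _) (Sum.inl ⟨a', hne⟩ : Graft A a B)
      (comp_graftColor f α a β) (Q.comp a p q (congrArg f hq)) r (congrArg f hr) (congrArg f hr)
    have e₂ := Q.map_comp_left (Equiv.refl _) (Sum.inl ⟨a, hne.symm⟩ : Graft A a' C)
      (comp_graftColor f α a' γ) (Q.comp a' p r (congrArg f hr)) q (congrArg f hq) (congrArg f hq)
    refine (congrArg _ e₁).trans (Eq.trans ?_ (congrArg _ (congrArg _ e₂)).symm)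
    have e₃ := Q.comp_par a a' hne p q r (congrArg f hq) (congrArg f hr)
    refine (congrArg _ (congrArg _ e₃)).trans ?_
    refine (congrArg _ (Q.map_trans _ _ _ _ _).symm).trans ((Q.map_trans _ _ _ _ _).symm.trans ?_)
    refine Eq.trans ?_ (congrArg _ (Q.map_trans _ _ _ _ _))
    refine Eq.trans ?_ (Q.map_trans _ _ _ _ _)
    refine Q.map_congr (Equiv.ext ?_) _ _ _
    rintro (⟨i | j, h⟩ | l) <;> rfl
  map_add φ _ _ _ _ := Q.map_add φ _
  map_smul φ _ _ _ _ := Q.map_smul φ _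
  add_comp a _ _ _ _ p p' q _ := (congrArg _ (Q.add_comp a p p' q _)).trans (Q.map_add _ _ _ _)
  smul_comp a _ _ _ _ c p q _ := (congrArg _ (Q.smul_comp a c p q _)).trans (Q.map_smul _ _ _ _)
  comp_add a _ _ _ _ p q q' _ := (congrArg _ (Q.comp_add a p q q' _)).trans (Q.map_add _ _ _ _)
  comp_smul a _ _ _ _ c p q _ := (congrArg _ (Q.comp_smul a c p q _)).trans (Q.map_smul _ _ _ _)

/-- The pull-back of an algebra with a uniform underlying graded vector space. -/
def Hom.pullbackUniform {Q : LinOperad.{u, w, v} k Ω} {V : Type x} [AddCommGroup V] [Module k V]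
    (Φ : Q.GradedAlgebra fun _ : Ω => V) : (Q.pullback f).GradedAlgebra fun _ : Ω' => V where
  app A _ α ω p := Φ.app A (f ∘ α) (f ω) p
  app_map φ α β ω h p := by
    refine MultilinearMap.ext fun v => ?_
    refine (congrArg (fun g => endOp g v) (Φ.app_map φ (fun i => congrArg f (h i)) p)).trans ?_
    exact (endOp_map φ _ _ v).trans (endOp_map φ h (Φ.app _ (f ∘ β) (f ω) p) v).symm
  app_one ω := Φ.app_one (f ω)
  app_comp a α β ω ζ p q h := by
    refine MultilinearMap.ext fun v => ?_
    refine (congrArg (fun g => endOp g v) (Φ.app_map (Equiv.refl _) (comp_graftColor f α a β)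
      (Q.comp a p q (congrArg f h)))).trans ?_
    refine (endOp_map (Equiv.refl _) _ _ v).trans ?_
    refine (congrArg (fun g => endOp g v) (Φ.app_comp a p q (congrArg f h))).trans ?_
    refine (endOp_comp a _ _ (congrArg f h) v).trans ?_
    exact (endOp_comp (α := α) (β := β) (ω := ω) (ζ := ζ) a
      (Φ.app _ (f ∘ α) (f ω) p) (Φ.app _ (f ∘ β) (f ζ) q) h v).symm
  app_add p q := Φ.app_add p q
  app_smul c p := Φ.app_smul c p

/-! ### Operads concentrated in one colour -/

section concentrated

variable {Q : LinOperad.{u, w, v} k Ω} {ω₀ : Ω}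

theorem completedSingle_self {A : Type} [Finite A] (α : A → Ω) (ω : Ω) (p : Q.obj A α ω) :
    Q.completedSingle α ω p (α, ω) = p := by
  classical
  convert! Pi.single_eq_same (M := fun c : (A → Ω) × Ω => Q.obj A c.1 c.2) (α, ω) p

open Classical in
/-- The inclusion of a component in the completed forgetful image, as a linear map. -/
def completedSingleL {A : Type} [Finite A] (α : A → Ω) (ω : Ω) : Q.obj A α ω →ₗ[k] Q.Completed A :=
  LinearMap.single k (fun c : (A → Ω) × Ω => Q.obj A c.1 c.2) (α, ω)

theorem completedSingleL_apply {A : Type} [Finite A] (α : A → Ω) (ω : Ω) (p : Q.obj A α ω) :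
    completedSingleL α ω p = Q.completedSingle α ω p := rfl

variable (Q ω₀) in
/-- All components of `Q` vanish, but possibly those in which all colours are `ω₀`. -/
def ConcentratedIn : Prop :=
  ∀ (A : Type) [Finite A] (c : (A → Ω) × Ω), c ≠ (fun _ => ω₀, ω₀) → ∀ p : Q.obj A c.1 c.2, p = 0

theorem completedCompTerm_eq_zero (hQ : Q.ConcentratedIn ω₀) {A B : Type} [Finite A]
    [Finite B] (a : A) (p : Q.Completed A) (q : Q.Completed B) (c : (Graft A a B → Ω) × Ω)
    {ζ : Ω} (hζ : ζ ≠ ω₀) :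
    completedCompTerm a p q c ζ = 0 := by
  have e : q (c.1 ∘ Sum.inr, ζ) = 0 := hQ B _ (fun h => hζ (congrArg Prod.snd h)) _
  have e' : Q.comp a (p (insertColor a c.1 ζ, c.2)) (q (c.1 ∘ Sum.inr, ζ))
      (insertColor_self a c.1 ζ) = 0 := by
    rw [e]
    exact (Q.compL a (insertColor_self a c.1 ζ) (p (insertColor a c.1 ζ, c.2))).map_zero
  exact (congrArg (Q.mapL (Equiv.refl _) (graftColor_insertColor a c.1 ζ)) e').trans
    (_root_.map_zero _)

variable (hQ : Q.ConcentratedIn ω₀)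

/-- The product of all components of arity `A` of an operad concentrated in the colour `ω₀` is its
component of colour `ω₀`. -/
def concentratedEquiv (A : Type) [Finite A] :
    Q.obj A (fun _ => ω₀) ω₀ ≃ₗ[k] Q.Completed A where
  __ := completedSingleL (fun _ => ω₀) ω₀
  invFun p := p (fun _ => ω₀, ω₀)
  left_inv p := completedSingle_self _ _ p
  right_inv p := by
    funext c
    by_cases hc : c = (fun _ => ω₀, ω₀)
    · subst hc
      exact completedSingle_self _ _ _
    · exact (hQ A c hc _).trans (hQ A c hc _).symm

theorem concentratedEquiv_apply {A : Type} [Finite A] (p : Q.obj A (fun _ => ω₀) ω₀) :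
    concentratedEquiv hQ A p (fun _ => ω₀, ω₀) = p :=
  completedSingle_self _ _ p

theorem concentratedEquiv_eq_of {A : Type} [Finite A] {p : Q.obj A (fun _ => ω₀) ω₀}
    {q : Q.Completed A} (h : q (fun _ => ω₀, ω₀) = p) : concentratedEquiv hQ A p = q :=
  (LinearEquiv.eq_symm_apply _).1 h.symm

theorem concentratedEquiv_symm_completedSingle {A : Type} [Finite A] {α : A → Ω} {ω : Ω}
    (h : (α, ω) ≠ (fun _ => ω₀, ω₀)) (p : Q.obj A α ω) :
    (concentratedEquiv hQ A).symm (Q.completedSingle α ω p) = 0 := by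
  rw [hQ A (α, ω) h p, ← completedSingleL_apply, _root_.map_zero, _root_.map_zero]

theorem completedCompTerm_concentrated {A B : Type} [Finite A] [Finite B] (a : A)
    (p : Q.obj A (fun _ => ω₀) ω₀) (q : Q.obj B (fun _ => ω₀) ω₀) :
    completedCompTerm a (concentratedEquiv hQ A p) (concentratedEquiv hQ B q)
        (fun _ => ω₀, ω₀) ω₀ =
      (Q.pullback fun _ : Unit => ω₀).comp (α := fun _ => ()) (β := fun _ => ()) (ω := ())
        (ζ := ()) a p q rfl := by
  -- `insertColor` of the constant colouring is constant, but only propositionally so.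
  have key : ∀ (α : A → Ω) (_ : α = fun _ => ω₀) (h : ω₀ = α a)
      (h' : ∀ i, ω₀ = graftColor α a (fun _ : B => ω₀) (Equiv.refl _ i)),
      Q.map (Equiv.refl _) h' (Q.comp a (concentratedEquiv hQ A p (α, ω₀))
        (concentratedEquiv hQ B q (fun _ => ω₀, ω₀)) h) =
      (Q.pullback fun _ : Unit => ω₀).comp (α := fun _ => ()) (β := fun _ => ()) (ω := ())
        (ζ := ()) a p q rfl := by
    rintro _ rfl h h'
    rw [concentratedEquiv_apply, concentratedEquiv_apply]
    rfl
  refine key _ (funext fun i => ?_) _ _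
  by_cases h : i = a <;> simp [insertColor, h]

/-- The restriction to the colour `ω₀` of an operad concentrated in that colour is its completed
forgetful image. -/
def concentratedForget : Q.CompletedForget (Q.pullback fun _ : Unit => ω₀) where
  equiv A _ := concentratedEquiv hQ A
  equiv_map φ p := concentratedEquiv_eq_of hQ
    (congrArg (Q.map φ fun _ => rfl) (concentratedEquiv_apply hQ p))
  equiv_one := concentratedEquiv_eq_of hQ
    ((dif_pos rfl).trans (Q.map_refl (Q.one ω₀)))
  finite_comp a p q c := (Set.finite_singleton ω₀).subset fun ζ hζ => by
    by_contra h
    exact hζ (completedCompTerm_eq_zero hQ a _ _ c h)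
  equiv_comp a p q c := by
    by_cases hc : c = (fun _ => ω₀, ω₀)
    · subst hc
      rw [finsum_eq_single _ ω₀ fun ζ hζ => completedCompTerm_eq_zero hQ a _ _ _ hζ]
      exact (concentratedEquiv_apply hQ _).trans (completedCompTerm_concentrated hQ a p q).symm
    · exact (hQ _ c hc _).trans (hQ _ c hc _).symm

end concentrated

end LinOperad

/-! ### The color-mixing operad -/

namespace Presentation

variable {k : Type u} [Field k] {𝔓 : Presentation.{u, v} k} {Ω : Type w} (ρ : 𝔓.SetAlgebra Ω)

/-- As soon as there are two distinct colours, the ideal `𝒥` is everything: the identity monomial of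
colour `ω' → ω` with `ω' ≠ ω` lies in `ℐ`, and its composition with any `p` of output colour `ω'`
is `p` with output colour `ω`. -/
theorem mem_badIdeal [Nontrivial Ω] {A : Type} [Finite A] (α : A → Ω) (ω : Ω)
    (p : (𝔓.freeLin.uniform Ω).obj A α ω) : p ∈ ρ.badIdeal.carrier A α ω := by
  obtain ⟨ω', hω⟩ := exists_ne ω
  have hone : 𝔓.mono ((freeOperad 𝔓.gen).one ()) ∈ ρ.badIdeal.carrier Unit (fun _ => ω') ω :=
    LinOperad.subset_idealGen _ _ (Submodule.subset_span
      ⟨_, fun h => hω ((ρ.eval_one ω').symm.trans h), rfl⟩)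
  have hcomp := ρ.badIdeal.comp_mem_left (β := α) (ζ := ω') () _ p rfl hone
  have hmap := ρ.badIdeal.map_mem (unitGraft A).symm (α := α)
    (fun i => (graftColor_unitGraft ω' α ((unitGraft A).symm i)).symm) _ hcomp
  have e : (𝔓.freeLin.uniform Ω).map (unitGraft A).symm
      (fun i => (graftColor_unitGraft ω' α ((unitGraft A).symm i)).symm)
      ((𝔓.freeLin.uniform Ω).comp () (α := fun _ => ω') (β := α) (ω := ω) (ζ := ω')
        (𝔓.mono ((freeOperad 𝔓.gen).one ())) p rfl) = p := by
    refine (congrArg (𝔓.freeLin.map (unitGraft A).symm fun _ => rfl)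
      (𝔓.freeLin.one_comp p)).trans ?_
    refine (𝔓.freeLin.map_trans _ _ _ _ _).symm.trans ?_
    exact (𝔓.freeLin.map_congr (Equiv.symm_trans_self _) _ _ _).trans (𝔓.freeLin.map_refl p)
  exact e ▸ hmap

/-- The color-mixing operad is concentrated in any given colour: for at least two colours it
vanishes altogether. -/
theorem colorMixing_concentratedIn (ω₀ : Ω) : ρ.colorMixing.ConcentratedIn ω₀ := by
  intro A _ c hc p
  have : Nontrivial Ω := by
    by_contra h
    have := not_nontrivial_iff_subsingleton.1 h
    exact hc (Subsingleton.elim _ _)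
  obtain ⟨p, rfl⟩ := Submodule.mkQ_surjective _ p
  obtain ⟨p, rfl⟩ := Submodule.mkQ_surjective _ p
  exact (Submodule.Quotient.mk_eq_zero _).2 ⟨p, mem_badIdeal ρ c.1 c.2 p, rfl⟩

/-- The morphism `𝒫̃^Ω → 𝒫^Ω → 𝒫^Ω / π(𝒥)`. -/
def subToMixing : ρ.colorSub.toOperad.Hom ρ.colorMixing :=
  ρ.colorSub.incl.trans ((𝔓.operad.uniform Ω).quotMk ρ.imageIdeal)

end Presentation

end

end FamilyAlg

theorem mainTheorem11 {k : Type u} [Field k] (𝔓 : Presentation.{u, v} k) {Ω : Type w}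
    (ρ : 𝔓.SetAlgebra Ω) (V : Type x) [AddCommGroup V] [Module k V] :
    -- algebras over the color-mixing operad: `V ⊗ kΩ` is a `𝒫`-algebra
    (∀ Φ : ρ.FamilyAlgebra V,
      ∃! Ψ : 𝔓.operad.Algebra (V ⊗[k] (Ω →₀ k)),
        ∀ (A : Type) [Finite A] (μ : 𝔓.Mon A) (α : A → Ω) (v : A → V),
          Ψ.act (𝔓.projMon μ) (fun a => v a ⊗ₜ[k] Finsupp.single (α a) (1 : k)) =
            Φ.uniformAct (ρ.mixProj α (ρ.eval μ α) (𝔓.projMon μ)) v ⊗ₜ[k]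
              Finsupp.single (ρ.eval μ α) (1 : k)) ∧
    -- the same for algebras over the coloured suboperad `𝒫̃^Ω` of which it is a quotient
    (∀ Φ : ρ.colorSub.toOperad.GradedAlgebra (fun _ : Ω => V),
      ∃! Ψ : 𝔓.operad.Algebra (V ⊗[k] (Ω →₀ k)),
        ∀ (A : Type) [Finite A] (μ : 𝔓.Mon A) (α : A → Ω) (v : A → V),
          Ψ.act (𝔓.projMon μ) (fun a => v a ⊗ₜ[k] Finsupp.single (α a) (1 : k)) =
            Φ.uniformAct (ρ.subMon μ α) v ⊗ₜ[k] Finsupp.single (ρ.eval μ α) (1 : k)) ∧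
    -- `V` is an algebra over the completed forgetful image of the color-mixing operad
    (Nonempty Ω → ∀ Φ : ρ.FamilyAlgebra V,
      ∃ (F : LinOperad.{u, 0, max u 1 v} k Unit) (e : ρ.colorMixing.CompletedForget F)
        (Θ : F.Algebra V),
        ∀ (A : Type) [Finite A] (α : A → Ω) (ω : Ω) (p : ρ.colorMixing.obj A α ω),
          Θ.act ((e.equiv A).symm (ρ.colorMixing.completedSingle α ω p)) = Φ.uniformAct p) := by
  refine ⟨fun Φ => Presentation.existsUnique_tensorAlgebra ((Presentation.subToMixing ρ).trans Φ),
    fun Φ => Presentation.existsUnique_tensorAlgebra Φ, ?_⟩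
  rintro ⟨ω₀⟩ Φ
  have hQ := Presentation.colorMixing_concentratedIn ρ ω₀
  refine ⟨_, LinOperad.concentratedForget hQ, Φ.pullbackUniform fun _ => ω₀,
    fun A _ α ω p => ?_⟩
  by_cases h : (α, ω) = (fun _ => ω₀, ω₀)
  · obtain ⟨rfl, rfl⟩ := Prod.mk.inj h
    exact congrArg Φ.uniformAct (LinOperad.completedSingle_self _ _ p)
  · obtain rfl := hQ A (α, ω) h p
    refine (congrArg Φ.uniformAct
      (LinOperad.concentratedEquiv_symm_completedSingle hQ h 0)).trans ?_
    exact (_root_.map_zero (Φ.appL A (fun _ => ω₀) ω₀)).trans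
      (_root_.map_zero (Φ.appL A α ω)).symm
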